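/- **Setting.** Let $U$ be a unitary on $\mathbb C^d\otimes\mathbb C^d$ (systems $A,B$), let $|\Phi_m\rangle=m^{-1/2}\sum_{j=1}^m|j\rangle|j\rangle$, and let $|\Psi_U\rangle=U^{AB}|\Phi_d\rangle^{AR_A}|\Phi_d\rangle^{BR_B}$ with reference systems $R_A,R_B$. Alice holds $A^nA_0$ and Bob holds $B^nB_0$. An $r$-round LOCC operation consists of $r$ alternating rounds, the first one by Alice; in each round one party performs a local measurement (a quantum instrument with finitely many outcomes, possibly depending on all earlier messages) and communicates the outcome to the other party, and after the last round the parties apply local channels depending on all the messages. An $(r,n,\epsilon)$-protocol for $U$ is an $r$-round LOCC operation $\mathcal M$ from $A^nA_0\otimes B^nB_0$ to $A^nA_1\otimes B^nB_1$, where $\dim A_0=\dim B_0=K\ge 1$ and $\dim A_1=\dim B_1=L\ge 1$, such that $$F\Big((\mathcal M\otimes \mathrm{id}_{R_A^nR_B^n})\big(|\Phi_d\rangle^{\otimes n}_{AR_A}|\Phi_d\rangle^{\otimes n}_{BR_B}|\Phi_K\rangle_{A_0B_0}\big),\ |\Psi_U\rangle^{\otimes n}|\Phi_L\rangle_{A_1B_1}\Big)\ge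 1-\epsilon,$$ where $F(\rho,\sigma)=\big(\mathrm{Tr}\sqrt{\sqrt\rho\,\sigma\sqrt\rho}\big)^2$ and a vector stands for its rank-one projector. Its entanglement cost is $\log_2K-\log_2L$. A rate $E\in\mathbb R$ is achievable by $r$-round protocols for $U$ if there are $n_\epsilon\in\mathbb N$ ($\epsilon>0$) with $\lim_{\epsilon\to0}\epsilon\, n_\epsilon^4=0$ such that for every $\epsilon>0$ and every $n\ge n_\epsilon$ there is an $(r,n,\epsilon)$-protocol for $U$ with entanglement cost $nE$. The $r$-round entanglement cost $E_r(U)\in[-\infty,\infty]$ is the infimum of the achievable rates. For real $\theta$ let $U_\theta=|0\rangle\langle0|\otimes I+|1\rangle\langle1|\otimes e^{i\theta\sigma_z}$ on two qubits, with $\sigma_z=\mathrm{diag}(1,-1)$. For $\theta>0$ let $$E_\theta=1-p_\theta+h\big(\cos^2(\sqrt\theta/2)\big),\qquad p_\theta=\frac{\sin^2\sqrt\theta}{2\,(1-\cos\theta\cos\sqrt\theta)},\qquad h(x)=-x\log_2x-(1-x)\log_2(1-x).$$ **Theorem.** 1. $E_4(U_\theta)\le E_\theta$ for every $\theta\in(0,\pi/2]$.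 2. $\lim_{\theta\to0^+}E_\theta=0$. 3. There is a constant $\theta_{\max}\in(0,\pi/2]$ such that $E_4(U_\theta)<1$ for every $\theta\in(0,\theta_{\max}]$. 4. $\lim_{\theta\to0^+}E_4(U_\theta)=0$. -/

import Mathlib

open Matrix Filter Topology
open scoped Kronecker MatrixOrder

namespace RoundTradeoff

noncomputable section

/-! ### Quantum operations and LOCC

A system with orthonormal basis indexed by a finite type `a` has operators `Matrix a a ℂ`;
the bipartite system of Alice (`a`) and Bob (`b`) is indexed by `a × b`. -/

/-- The completely positive map `ρ ↦ ∑ i, K i ρ (K i)†` with Kraus operators `K`. -/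
def krausMap {x y ι : Type} [Fintype x] [Fintype ι] (K : ι → Matrix y x ℂ) :
    Matrix x x ℂ →ₗ[ℂ] Matrix y y ℂ where
  toFun ρ := ∑ i, K i * ρ * (K i)ᴴ
  map_add' ρ σ := by simp only [Matrix.mul_add, Matrix.add_mul, Finset.sum_add_distrib]
  map_smul' t ρ := by
    simp only [Matrix.mul_smul, Matrix.smul_mul, Finset.smul_sum, RingHom.id_apply]

/-- The Kraus operators `K` describe a channel: `∑ i, (K i)† (K i) = 1`. -/
def IsChannel {x y ι : Type} [Fintype y] [DecidableEq x] [Fintype ι]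
    (K : ι → Matrix y x ℂ) : Prop :=
  ∑ i, (K i)ᴴ * K i = 1

/-- The operators `K k i` describe a quantum measurement (instrument) with outcomes `k`: outcome
`k` occurs with the subnormalized post-measurement state `∑ i, K k i ρ (K k i)†`. -/
def IsInstrument {x y κ ι : Type} [Fintype y] [DecidableEq x] [Fintype κ] [Fintype ι]
    (K : κ → ι → Matrix y x ℂ) : Prop :=
  ∑ k, ∑ i, (K k i)ᴴ * K k i = 1

/-- The two parties. -/
inductive Party
  | alice
  | bob

/-- `IsLOCC a' b' r s a b M`: the map `M`, from operators on the bipartite system `a × b` to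
operators on the bipartite system `a' × b'`, is realized by an LOCC protocol with `r` rounds of
communication whose first message is sent by the party `s`, the two parties alternating.
In each round the sender performs a measurement (into an arbitrary system `c`) and
communicates the outcome `k`; everything that is done later may depend on `k`. After the last
round the parties apply local channels. -/
def IsLOCC (a' b' : Type) [Fintype a'] [Fintype b'] :
    ℕ → Party → ∀ (a b : Type) [Fintype a] [DecidableEq a] [Fintype b] [DecidableEq b],
      (Matrix (a × b) (a × b) ℂ →ₗ[ℂ] Matrix (a' × b') (a' × b') ℂ) → Prop
  | 0, _, a, b, _, _, _, _, M =>
      ∃ (ι ι' : Type) (_ : Fintype ι) (_ : Fintype ι')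
        (F : ι → Matrix a' a ℂ) (G : ι' → Matrix b' b ℂ),
        IsChannel F ∧ IsChannel G ∧ M = krausMap (fun p : ι × ι' => F p.1 ⊗ₖ G p.2)
  | r + 1, Party.alice, a, b, _, _, _, _, M =>
      ∃ (c κ ι : Type) (_ : Fintype c) (_ : DecidableEq c) (_ : Fintype κ) (_ : Fintype ι)
        (K : κ → ι → Matrix c a ℂ)
        (P : κ → (Matrix (c × b) (c × b) ℂ →ₗ[ℂ] Matrix (a' × b') (a' × b') ℂ)),
        IsInstrument K ∧ (∀ k, IsLOCC a' b' r Party.bob c b (P k)) ∧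
          M = ∑ k, P k ∘ₗ krausMap (fun i => K k i ⊗ₖ (1 : Matrix b b ℂ))
  | r + 1, Party.bob, a, b, _, _, _, _, M =>
      ∃ (c κ ι : Type) (_ : Fintype c) (_ : DecidableEq c) (_ : Fintype κ) (_ : Fintype ι)
        (K : κ → ι → Matrix c b ℂ)
        (P : κ → (Matrix (a × c) (a × c) ℂ →ₗ[ℂ] Matrix (a' × b') (a' × b') ℂ)),
        IsInstrument K ∧ (∀ k, IsLOCC a' b' r Party.alice a c (P k)) ∧
          M = ∑ k, P k ∘ₗ krausMap (fun i => (1 : Matrix a a ℂ) ⊗ₖ K k i)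

/-- `M ⊗ id` on the system `x` together with a reference system `R`: `M` is applied to each
block of `X` in the reference basis. -/
def withReference {x y R : Type} (M : Matrix x x ℂ →ₗ[ℂ] Matrix y y ℂ)
    (X : Matrix (x × R) (x × R) ℂ) : Matrix (y × R) (y × R) ℂ :=
  Matrix.of fun p q => M (Matrix.of fun i j => X (i, p.2) (j, q.2)) p.1 q.1

/-! ### States and fidelity -/

/-- The operator `|ψ⟩⟨ψ|`. -/
def pureState {x : Type} (ψ : x → ℂ) : Matrix x x ℂ :=
  Matrix.vecMulVec ψ (star ψ)

/-- `F(ρ, σ) = (Tr √(√ρ σ √ρ))²`. -/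
def fidelity {x : Type} [Fintype x] [DecidableEq x] (ρ σ : Matrix x x ℂ) : ℝ :=
  (Matrix.trace (CFC.sqrt (CFC.sqrt ρ * σ * CFC.sqrt ρ))).re ^ 2

/-- The maximally entangled vector `|Φ_d⟩ = d^{-1/2} ∑ j, |j⟩|j⟩` of Schmidt rank `d`. -/
def maxEnt (d : ℕ) (i j : Fin d) : ℂ :=
  if i = j then ((Real.sqrt d)⁻¹ : ℝ) else 0

/-- `|Ψ_U⟩ = U^{AB} |Φ_d⟩^{A R_A} |Φ_d⟩^{B R_B}`, indexed by `(A × B) × (R_A × R_B)`. -/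
def gateState {d : ℕ} (U : Matrix (Fin d × Fin d) (Fin d × Fin d) ℂ) :
    (Fin d × Fin d) × (Fin d × Fin d) → ℂ :=
  fun p => (U *ᵥ fun q => maxEnt d q.1 p.2.1 * maxEnt d q.2 p.2.2) p.1

/-- One party's laboratory: `n` systems of dimension `d` and a register of dimension `k`. -/
abbrev Lab (d n k : ℕ) : Type := (Fin n → Fin d) × Fin k

/-- The reference systems `R_A^n × R_B^n`. -/
abbrev Refs (d n : ℕ) : Type := (Fin n → Fin d) × (Fin n → Fin d)

/-- `|Φ_d⟩^{⊗n} |Φ_d⟩^{⊗n} |Φ_K⟩` on `A^n R_A^n`, `B^n R_B^n` and `A₀ B₀`. -/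
def inputVec (d n K : ℕ) : (Lab d n K × Lab d n K) × Refs d n → ℂ :=
  fun p => (∏ i, maxEnt d (p.1.1.1 i) (p.2.1 i)) * (∏ i, maxEnt d (p.1.2.1 i) (p.2.2 i)) *
    maxEnt K p.1.1.2 p.1.2.2

/-- `|Ψ_U⟩^{⊗n} |Φ_L⟩` on `A^n B^n R_A^n R_B^n` and `A₁ B₁`. -/
def targetVec {d : ℕ} (U : Matrix (Fin d × Fin d) (Fin d × Fin d) ℂ) (n L : ℕ) :
    (Lab d n L × Lab d n L) × Refs d n → ℂ :=
  fun p => (∏ i, gateState U ((p.1.1.1 i, p.1.2.1 i), (p.2.1 i, p.2.2 i))) *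
    maxEnt L p.1.1.2 p.1.2.2

/-! ### Entanglement cost -/

/-- `M : A^n A₀ ⊗ B^n B₀ → A^n A₁ ⊗ B^n B₁` is an `(r, n, ε)`-protocol for implementing `U`, with
resource `Φ_K` and output entanglement `Φ_L`. Alice sends the first message. -/
def IsProtocol {d : ℕ} (U : Matrix (Fin d × Fin d) (Fin d × Fin d) ℂ) (r n : ℕ) (ε : ℝ)
    (K L : ℕ)
    (M : Matrix (Lab d n K × Lab d n K) (Lab d n K × Lab d n K) ℂ →ₗ[ℂ]
      Matrix (Lab d n L × Lab d n L) (Lab d n L × Lab d n L) ℂ) : Prop :=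
  IsLOCC (Lab d n L) (Lab d n L) r Party.alice (Lab d n K) (Lab d n K) M ∧
    1 - ε ≤ fidelity (withReference M (pureState (inputVec d n K))) (pureState (targetVec U n L))

/-- The rate `E` is achievable by an `r`-round protocol for implementing `U`; `N ε` is the
threshold for the number of copies. -/
def Achievable {d : ℕ} (U : Matrix (Fin d × Fin d) (Fin d × Fin d) ℂ) (r : ℕ) (E : ℝ) : Prop :=
  ∃ N : ℝ → ℕ,
    (∀ ε : ℝ, 0 < ε → ∀ n : ℕ, N ε ≤ n → ∃ K L : ℕ, 1 ≤ K ∧ 1 ≤ L ∧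
      (∃ M, IsProtocol U r n ε K L M) ∧ Real.logb 2 K - Real.logb 2 L = n * E) ∧
    Tendsto (fun ε : ℝ => ε * (N ε : ℝ) ^ 4) (𝓝[>] 0) (𝓝 0)

/-- `E_r(U)`, the infimum of the achievable rates, taken in the extended reals (so that it
is `⊤` if no rate is achievable and `⊥` if the rates are unbounded below). -/
def entanglementCost {d : ℕ} (r : ℕ) (U : Matrix (Fin d × Fin d) (Fin d × Fin d) ℂ) : EReal :=
  sInf ((fun E : ℝ => (E : EReal)) '' {E : ℝ | Achievable U r E})

/-! ### The gate and the bound -/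

/-- The Pauli matrix `σ_z`. -/
def sigmaZ : Matrix (Fin 2) (Fin 2) ℂ := !![1, 0; 0, -1]

/-- `U_θ = |0⟩⟨0| ⊗ I + |1⟩⟨1| ⊗ exp(i θ σ_z)`. -/
def gate (θ : ℝ) : Matrix (Fin 2 × Fin 2) (Fin 2 × Fin 2) ℂ :=
  Matrix.single 0 0 1 ⊗ₖ (1 : Matrix (Fin 2) (Fin 2) ℂ) +
    Matrix.single 1 1 1 ⊗ₖ NormedSpace.exp ((Complex.I * (θ : ℂ)) • sigmaZ)

/-- The binary entropy, with base-2 logarithms. -/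
def binEnt (x : ℝ) : ℝ := -x * Real.logb 2 x - (1 - x) * Real.logb 2 (1 - x)

/-- `p(α, θ) = sin² α / (2 (1 - cos θ cos α))`. -/
def successProb (α θ : ℝ) : ℝ :=
  Real.sin α ^ 2 / (2 * (1 - Real.cos θ * Real.cos α))

/-- `E_θ = 1 - p_θ + h(cos²(√θ / 2))`, where `p_θ = p(√θ, θ)`. -/
def rateBound (θ : ℝ) : ℝ :=
  1 - successProb (Real.sqrt θ) θ + binEnt (Real.cos (Real.sqrt θ / 2) ^ 2)

end

end RoundTradeoff

open scoped ComplexOrder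

namespace RoundTradeoff

/-! ### Kraus maps and the fidelity with a pure state -/

section Kraus

variable {x y z κ ι R : Type} [Fintype x] [Fintype κ] [Fintype ι]

/-! Upper bound, one copy. Put C = cos(θ/2), S = sin(θ/2), a = cos(√θ/2), b = sin(√θ/2), z =
(-1)^(x+y). Up to a phase applied by Bob, the gate multiplies |x,y⟩ by C - iSz. The parties share
a|00⟩ + b|11⟩; each flips the sign of |1⟩ under the control of the data bit. Alice measures her half
in the Fourier basis, Bob undoes the resulting sign and measures his half in a tilted basis. Outcome
s multiplies |x,y⟩ by u + ivz with real u, v, which has constant modulus, so it acts as a diagonal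
unitary. The tilt is chosen so that s = 0, which has probability p_θ, gives C - iSz; s = 1 gives a
wrong phase, repaired with one further ebit: Alice hands over x coherently, Bob applies the phase
and measures the handed-over bit in the Fourier basis, Alice fixes a sign. This takes four messages
(`exists_siteProtocol`).

Upper bound, n copies. The resource is truncated to a typical set T of about 2^(n h(a²)) strings and
diluted from Φ_K; with high probability about n(1 - p_θ) copies fail, so about that many ebits
suffice for the repairs. Hence log K - log L is about n E_θ. `SiteProtocol.exists_isLOCC` bounds the
fidelity below by ∑ (∑ ∏ amp)², which `one_sub_le_sum_sq_sum_prod` bounds below by 1 minus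
atypicality probabilities. A Chernoff bound makes these exponentially small, so n_ε = O(log 1/ε) and
ε n_ε⁴ → 0.

Lower bound. An LOCC map is separable, and a product Kraus operator turns Φ_K into a vector of
Schmidt rank at most K, while the squared Schmidt coefficients of the target are at most 1/L. The
fidelity is therefore at most K/L (`fidelity_le_of_isLOCC`), which excludes negative rates. Since
E_θ → 0, the cost is squeezed to 0. -/

theorem krausMap_apply (K : ι → Matrix y x ℂ) (ρ : Matrix x x ℂ) :
    krausMap K ρ = ∑ i, K i * ρ * (K i)ᴴ := rfl

theorem krausMap_comp [Fintype y] (F : κ → Matrix z y ℂ) (K : ι → Matrix y x ℂ) :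
    krausMap F ∘ₗ krausMap K = krausMap (fun p : κ × ι => F p.1 * K p.2) := by
  ext1 ρ
  simp only [LinearMap.comp_apply, krausMap_apply, Fintype.sum_prod_type, Matrix.mul_sum,
    Matrix.sum_mul, Matrix.conjTranspose_mul, Matrix.mul_assoc]

theorem sum_krausMap {ι : κ → Type} [∀ k, Fintype (ι k)] (K : ∀ k, ι k → Matrix y x ℂ) :
    ∑ k, krausMap (K k) = krausMap (fun p : Σ k, ι k => K p.1 p.2) := by
  ext1 ρ
  simp only [LinearMap.sum_apply, krausMap_apply, Fintype.sum_sigma]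

theorem krausMap_sumElim (F : κ → Matrix y x ℂ) (K : ι → Matrix y x ℂ) :
    krausMap (Sum.elim F K) = krausMap F + krausMap K := by
  ext1 ρ
  simp only [LinearMap.add_apply, krausMap_apply, Fintype.sum_sum_type, Sum.elim_inl,
    Sum.elim_inr]

/-- The vector `(K ⊗ 1) ψ`, where `1` is the identity of the reference system. -/
noncomputable def localAct (K : Matrix y x ℂ) (ψ : x × R → ℂ) : y × R → ℂ :=
  fun q => ∑ a, K q.1 a * ψ (a, q.2)

theorem withReference_krausMap_pureState (K : ι → Matrix y x ℂ) (ψ : x × R → ℂ) :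
    withReference (krausMap K) (pureState ψ) = ∑ i, pureState (localAct (K i) ψ) := by
  ext p q
  simp only [withReference, Matrix.of_apply, krausMap_apply, Matrix.sum_apply, pureState,
    Matrix.vecMulVec_apply, localAct, Matrix.mul_apply, Matrix.conjTranspose_apply, Pi.star_apply,
    star_sum, star_mul', Finset.sum_mul, Finset.mul_sum]
  refine Finset.sum_congr rfl fun i _ => Finset.sum_congr rfl fun a _ =>
    Finset.sum_congr rfl fun b _ => by ring

theorem pureState_nonneg (v : x → ℂ) : 0 ≤ pureState v :=
  (posSemidef_vecMulVec_self_star v).nonneg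

/-- The operator P = |v⟩⟨v| satisfies P² = ‖v‖² P. For v = 0 the convention 0⁻¹ = 0 is harmless. -/
theorem sqrt_pureState [DecidableEq x] (v : x → ℂ) :
    CFC.sqrt (pureState v) =
      (((Real.sqrt (∑ i, ‖v i‖ ^ 2))⁻¹ : ℝ) : ℂ) • pureState v := by
  set s : ℝ := ∑ i, ‖v i‖ ^ 2 with hs
  have hs0 : 0 ≤ s := Finset.sum_nonneg fun i _ => by positivity
  have hdot : star v ⬝ᵥ v = (s : ℂ) := by
    simp only [dotProduct, Pi.star_apply, hs, RCLike.star_def, Complex.conj_mul']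
    push_cast
    rfl
  have hpsd := pureState_nonneg v
  refine CFC.sqrt_unique ?_ ?_
  · rw [Matrix.smul_mul, Matrix.mul_smul, smul_smul]
    have h2 : pureState v * pureState v = (s : ℂ) • pureState v := by
      rw [pureState, vecMulVec_mul_vecMulVec, hdot]
      ext i j
      simp only [Matrix.vecMulVec_apply, Matrix.smul_apply, Pi.smul_apply, smul_eq_mul]
      ring
    rw [h2, smul_smul]
    rcases eq_or_lt_of_le hs0 with h | h
    · have hv : v = 0 := by
        funext i
        have := (Finset.sum_eq_zero_iff_of_nonneg (fun i _ => by positivity)).1 h.symm i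
          (Finset.mem_univ i)
        simpa using this
      simp [hv, pureState]
    · have : (((Real.sqrt s)⁻¹ : ℝ) : ℂ) * (((Real.sqrt s)⁻¹ : ℝ) : ℂ) * (s : ℂ) = 1 := by
        rw [← Complex.ofReal_mul, ← Complex.ofReal_mul, ← mul_inv, Real.mul_self_sqrt hs0,
          inv_mul_cancel₀ h.ne', Complex.ofReal_one]
      rw [this, one_smul]
  · rw [Matrix.nonneg_iff_posSemidef] at hpsd ⊢
    exact hpsd.smul (by
      rw [Complex.zero_le_real]
      positivity)

theorem trace_pureState (v : x → ℂ) :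
    Matrix.trace (pureState v) = ((∑ i, ‖v i‖ ^ 2 : ℝ) : ℂ) := by
  simp only [Matrix.trace, Matrix.diag, pureState, Matrix.vecMulVec_apply, Pi.star_apply,
    RCLike.star_def, Complex.mul_conj']
  push_cast
  rfl

/-- √ρ |t⟩⟨t| √ρ is the rank-one operator of √ρ t, and its square root has trace ‖√ρ t‖. -/
theorem fidelity_pureState [DecidableEq x] {ρ : Matrix x x ℂ} (hρ : 0 ≤ ρ) (t : x → ℂ) :
    fidelity ρ (pureState t) = (star t ⬝ᵥ (ρ *ᵥ t)).re := by
  have hsq := CFC.sqrt_mul_sqrt_self ρ hρ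
  have hsa : (CFC.sqrt ρ)ᴴ = CFC.sqrt ρ := (CFC.sqrt_nonneg ρ).isSelfAdjoint
  have h1 : CFC.sqrt ρ * pureState t * CFC.sqrt ρ = pureState (CFC.sqrt ρ *ᵥ t) := by
    rw [pureState, Matrix.mul_vecMulVec, Matrix.vecMulVec_mul, pureState]
    congr 1
    rw [Matrix.star_mulVec, hsa]
  have h2 : star t ⬝ᵥ (ρ *ᵥ t) = ((∑ i, ‖(CFC.sqrt ρ *ᵥ t) i‖ ^ 2 : ℝ) : ℂ) := by
    conv_lhs => rw [← hsq, ← Matrix.mulVec_mulVec, Matrix.dotProduct_mulVec]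
    have : star t ᵥ* CFC.sqrt ρ = star (CFC.sqrt ρ *ᵥ t) := by
      rw [Matrix.star_mulVec, hsa]
    rw [this]
    simp only [dotProduct, Pi.star_apply, RCLike.star_def, Complex.conj_mul']
    push_cast
    rfl
  rw [fidelity, h1, sqrt_pureState, Matrix.trace_smul, trace_pureState, h2, smul_eq_mul,
    ← Complex.ofReal_mul, Complex.ofReal_re, Complex.ofReal_re]
  set s : ℝ := ∑ i, ‖(CFC.sqrt ρ *ᵥ t) i‖ ^ 2
  have hs0 : 0 ≤ s := Finset.sum_nonneg fun i _ => by positivity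
  rw [mul_pow, inv_pow, Real.sq_sqrt hs0]
  rcases eq_or_lt_of_le hs0 with h | h
  · simp [← h]
  · field_simp

theorem fidelity_sum_pureState [DecidableEq x] (v : ι → x → ℂ) (t : x → ℂ) :
    fidelity (∑ i, pureState (v i)) (pureState t) = ∑ i, ‖star t ⬝ᵥ v i‖ ^ 2 := by
  rw [fidelity_pureState (Finset.sum_nonneg fun i _ => pureState_nonneg (v i)),
    Matrix.sum_mulVec, dotProduct_sum, Complex.re_sum]
  refine Finset.sum_congr rfl fun i _ => ?_
  rw [pureState, Matrix.vecMulVec_mulVec, dotProduct_smul]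
  have : star (v i) ⬝ᵥ t = star (star t ⬝ᵥ v i) := Matrix.star_dotProduct _ _
  simp only [this, MulOpposite.smul_eq_mul_unop, MulOpposite.unop_op, RCLike.star_def,
    Complex.mul_conj', ← Complex.ofReal_pow, Complex.ofReal_re]

end Kraus

theorem fidelity_krausMap {x y ι R : Type} [Fintype x] [Fintype y] [DecidableEq y] [Fintype ι]
    [Fintype R] [DecidableEq R]
    (K : ι → Matrix y x ℂ) (ψ : x × R → ℂ) (t : y × R → ℂ) :
    fidelity (withReference (krausMap K) (pureState ψ)) (pureState t) =
      ∑ i, ‖star t ⬝ᵥ localAct (K i) ψ‖ ^ 2 := by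
  rw [withReference_krausMap_pureState, fidelity_sum_pureState]

/-! ### LOCC maps as separable channels -/

theorem kronecker_conjTranspose_mul_self {a b c d : Type} [Fintype c] [Fintype d]
    (F : Matrix c a ℂ) (G : Matrix d b ℂ) :
    (F ⊗ₖ G)ᴴ * (F ⊗ₖ G) = (Fᴴ * F) ⊗ₖ (Gᴴ * G) := by
  rw [Matrix.conjTranspose_kronecker, ← Matrix.mul_kronecker_mul]

theorem sum_prod_kronecker {a b c d ι κ : Type} [Fintype ι] [Fintype κ]
    (F : ι → Matrix c a ℂ) (G : κ → Matrix d b ℂ) :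
    ∑ p : ι × κ, F p.1 ⊗ₖ G p.2 = (∑ i, F i) ⊗ₖ (∑ k, G k) := by
  ext p q
  simp only [Matrix.sum_apply, Matrix.kroneckerMap_apply, Fintype.sum_prod_type,
    Finset.sum_mul_sum]

theorem sum_kronecker_one {a b c ι : Type} [Fintype ι] [DecidableEq b] (F : ι → Matrix c a ℂ) :
    ∑ i, F i ⊗ₖ (1 : Matrix b b ℂ) = (∑ i, F i) ⊗ₖ (1 : Matrix b b ℂ) := by
  ext p q
  simp only [Matrix.sum_apply, Matrix.kroneckerMap_apply, Finset.sum_mul]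

theorem sum_one_kronecker {a b c ι : Type} [Fintype ι] [DecidableEq b] (F : ι → Matrix c a ℂ) :
    ∑ i, (1 : Matrix b b ℂ) ⊗ₖ F i = (1 : Matrix b b ℂ) ⊗ₖ (∑ i, F i) := by
  ext p q
  simp only [Matrix.sum_apply, Matrix.kroneckerMap_apply, Finset.mul_sum]

theorem isInstrument_kronecker_one {a b c κ ι : Type} [Fintype c] [DecidableEq a] [Fintype b]
    [DecidableEq b] [Fintype κ] [Fintype ι] {K : κ → ι → Matrix c a ℂ} (hK : IsInstrument K) :
    IsInstrument (fun k i => K k i ⊗ₖ (1 : Matrix b b ℂ)) := by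
  simp only [IsInstrument, kronecker_conjTranspose_mul_self, Matrix.conjTranspose_one,
    Matrix.one_mul, sum_kronecker_one] at hK ⊢
  rw [hK, Matrix.one_kronecker_one]

theorem isInstrument_one_kronecker {a b c κ ι : Type} [Fintype c] [DecidableEq a] [Fintype b]
    [DecidableEq b] [Fintype κ] [Fintype ι] {K : κ → ι → Matrix c a ℂ} (hK : IsInstrument K) :
    IsInstrument (fun k i => (1 : Matrix b b ℂ) ⊗ₖ K k i) := by
  simp only [IsInstrument, kronecker_conjTranspose_mul_self, Matrix.conjTranspose_one,
    Matrix.one_mul, sum_one_kronecker] at hK ⊢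
  rw [hK, Matrix.one_kronecker_one]

theorem IsInstrument.bind {x y z κ ι : Type} {μ : κ → Type} [Fintype y] [Fintype z]
    [DecidableEq x] [DecidableEq y] [Fintype κ] [Fintype ι] [∀ k, Fintype (μ k)]
    {K : κ → ι → Matrix y x ℂ} (hK : IsInstrument K) {F : ∀ k, μ k → Matrix z y ℂ}
    (hF : ∀ k, IsChannel (F k)) :
    IsChannel (fun p : Σ k, μ k × ι => F p.1 p.2.1 * K p.1 p.2.2) := by
  rw [IsChannel, Fintype.sum_sigma, ← hK]
  refine Finset.sum_congr rfl fun k _ => ?_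
  rw [Fintype.sum_prod_type, Finset.sum_comm]
  refine Finset.sum_congr rfl fun i _ => ?_
  have := hF k
  rw [IsChannel] at this
  calc _ = (K k i)ᴴ * (∑ j, (F k j)ᴴ * F k j) * K k i := by
        simp only [Matrix.conjTranspose_mul, Matrix.mul_sum, Matrix.sum_mul, Matrix.mul_assoc]
    _ = _ := by rw [this, Matrix.mul_one]

/-- Every LOCC map is a separable channel. -/
theorem IsLOCC.exists_separable {a' b' : Type} [Fintype a'] [Fintype b'] :
    ∀ (r : ℕ) (s : Party) (a b : Type) [Fintype a] [DecidableEq a] [Fintype b] [DecidableEq b]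
      (M : Matrix (a × b) (a × b) ℂ →ₗ[ℂ] Matrix (a' × b') (a' × b') ℂ),
      IsLOCC a' b' r s a b M →
      ∃ (ι : Type) (_ : Fintype ι) (F : ι → Matrix a' a ℂ) (G : ι → Matrix b' b ℂ),
        IsChannel (fun i => F i ⊗ₖ G i) ∧ M = krausMap (fun i => F i ⊗ₖ G i)
  | 0, _, a, b, _, _, _, _, M, h => by
    obtain ⟨ι, ι', _, _, F, G, hF, hG, rfl⟩ := h
    refine ⟨ι × ι', inferInstance, fun p => F p.1, fun p => G p.2, ?_, rfl⟩
    simp only [IsChannel] at *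
    simp only [kronecker_conjTranspose_mul_self]
    rw [sum_prod_kronecker (fun i => (F i)ᴴ * F i) (fun i => (G i)ᴴ * G i), hF, hG,
      Matrix.one_kronecker_one]
  | r + 1, Party.alice, a, b, _, _, _, _, M, h => by
    obtain ⟨c, κ, ι, _, _, _, _, K, P, hK, hP, rfl⟩ := h
    choose μ _ F G hFG hPe using fun k =>
      IsLOCC.exists_separable r Party.bob c b (P k) (hP k)
    refine ⟨Σ k, μ k × ι, inferInstance, fun p => F p.1 p.2.1 * K p.1 p.2.2,
      fun p => G p.1 p.2.1, ?_, ?_⟩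
    · have := (isInstrument_kronecker_one (b := b) hK).bind hFG
      simpa only [← Matrix.mul_kronecker_mul, Matrix.mul_one] using this
    · simp only [hPe, krausMap_comp, ← Matrix.mul_kronecker_mul, Matrix.mul_one, sum_krausMap]
  | r + 1, Party.bob, a, b, _, _, _, _, M, h => by
    obtain ⟨c, κ, ι, _, _, _, _, K, P, hK, hP, rfl⟩ := h
    choose μ _ F G hFG hPe using fun k =>
      IsLOCC.exists_separable r Party.alice a c (P k) (hP k)
    refine ⟨Σ k, μ k × ι, inferInstance, fun p => F p.1 p.2.1,
      fun p => G p.1 p.2.1 * K p.1 p.2.2, ?_, ?_⟩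
    · have := (isInstrument_one_kronecker (b := a) hK).bind hFG
      simpa only [← Matrix.mul_kronecker_mul, Matrix.mul_one] using this
    · simp only [hPe, krausMap_comp, ← Matrix.mul_kronecker_mul, Matrix.mul_one, sum_krausMap]

/-! ### Building LOCC maps with prescribed branches -/

/-- The operators `O` are among the Kraus operators of `M`. -/
def HasBranches {x y κ : Type} [Fintype x] [Fintype κ] (M : Matrix x x ℂ →ₗ[ℂ] Matrix y y ℂ)
    (O : κ → Matrix y x ℂ) : Prop :=
  ∃ (ι : Type) (_ : Fintype ι) (C : ι → Matrix y x ℂ), M = krausMap O + krausMap C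

/-- The Kraus operators `K` describe a trace-nonincreasing map. -/
def IsSubchannel {x y ι : Type} [Fintype y] [DecidableEq x] [Fintype ι]
    (K : ι → Matrix y x ℂ) : Prop :=
  ∑ i, (K i)ᴴ * K i ≤ 1

/-- The square root of the defect 1 - ∑ K†K is cut into its rows, and each row is sent to one fixed
output basis vector. So any nonempty output system will do, whatever its dimension. -/
theorem IsSubchannel.exists_completion {x y ι : Type} [Fintype x] [Fintype y] [DecidableEq x]
    [Fintype ι] [Nonempty y] {K : ι → Matrix y x ℂ} (hK : IsSubchannel K) :
    ∃ C : x → Matrix y x ℂ, IsChannel (Sum.elim K C) := by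
  classical
  set R : Matrix x x ℂ := 1 - ∑ i, (K i)ᴴ * K i with hR
  have hR0 : 0 ≤ R := sub_nonneg.2 hK
  set S := CFC.sqrt R
  have hS : Sᴴ * S = R := by
    rw [show Sᴴ = S from (CFC.sqrt_nonneg R).isSelfAdjoint, CFC.sqrt_mul_sqrt_self R hR0]
  obtain ⟨c⟩ := ‹Nonempty y›
  refine ⟨fun i => Matrix.of fun p q => if p = c then S i q else 0, ?_⟩
  rw [IsChannel, Fintype.sum_sum_type]
  have : ∑ i, (Matrix.of fun (p : y) (q : x) => if p = c then S i q else 0)ᴴ *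
      (Matrix.of fun (p : y) (q : x) => if p = c then S i q else 0) = Sᴴ * S := by
    ext p q
    simp [Matrix.sum_apply, Matrix.mul_apply]
  simp only [Sum.elim_inl, Sum.elim_inr]
  rw [this, hS, hR]
  abel

/-- Outcomes in `κ` are those of the protocol; outcomes in `μ` come from completing a subnormalized
measurement and only contribute unlisted Kraus operators. -/
theorem hasBranches_sum {x y z κ ι : Type} [Fintype x] [Fintype y] [Fintype κ] [Fintype ι]
    {μ : Type} [Fintype μ] {P : κ ⊕ μ → (Matrix y y ℂ →ₗ[ℂ] Matrix z z ℂ)}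
    {K : κ ⊕ μ → Matrix y x ℂ} {O : κ → ι → Matrix z y ℂ}
    (hP : ∀ k, HasBranches (P (Sum.inl k)) (O k))
    (hP' : ∀ m, HasBranches (P (Sum.inr m)) (fun e : Empty => e.elim)) :
    HasBranches (∑ k, P k ∘ₗ krausMap (fun _ : Unit => K k))
      (fun p : κ × ι => O p.1 p.2 * K (Sum.inl p.1)) := by
  choose α _ C hC using hP
  choose β _ D hD using hP'
  refine ⟨(Σ k, α k × Unit) ⊕ (Σ m, β m × Unit), inferInstance,
    Sum.elim (fun p => C p.1 p.2.1 * K (Sum.inl p.1))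
      (fun p => D p.1 p.2.1 * K (Sum.inr p.1)), ?_⟩
  have hempty : krausMap (fun e : Empty => (e.elim : Matrix z y ℂ)) = 0 := by
    ext1 ρ
    simp [krausMap_apply]
  have h1 : krausMap (fun p : κ × ι => O p.1 p.2 * K (Sum.inl p.1)) =
      ∑ k, krausMap (O k) ∘ₗ krausMap (fun _ : Unit => K (Sum.inl k)) := by
    ext1 ρ
    simp only [krausMap_apply, LinearMap.sum_apply, LinearMap.comp_apply, Fintype.sum_prod_type,
      Finset.univ_unique, Finset.sum_singleton, Matrix.conjTranspose_mul, Matrix.mul_assoc]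
  rw [krausMap_sumElim, h1, Fintype.sum_sum_type]
  simp only [hC, hD, hempty, zero_add, LinearMap.add_comp, Finset.sum_add_distrib, krausMap_comp,
    sum_krausMap, add_assoc]

theorem hasBranches_empty_krausMap {x y ι : Type} [Fintype x] [Fintype ι]
    (K : ι → Matrix y x ℂ) : HasBranches (krausMap K) (fun e : Empty => e.elim) := by
  refine ⟨ι, inferInstance, K, ?_⟩
  ext1 ρ
  simp [krausMap_apply]

section Build

variable {a' b' : Type} [Fintype a'] [Fintype b'] [Nonempty a'] [Nonempty b']

theorem exists_isLOCC_zero (s : Party) {a b : Type} [Fintype a] [DecidableEq a] [Fintype b]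
    [DecidableEq b] {F : Matrix a' a ℂ} {G : Matrix b' b ℂ}
    (hF : IsSubchannel fun _ : Unit => F) (hG : IsSubchannel fun _ : Unit => G) :
    ∃ M, IsLOCC a' b' 0 s a b M ∧ HasBranches M (fun _ : Unit => F ⊗ₖ G) := by
  obtain ⟨C, hC⟩ := hF.exists_completion
  obtain ⟨D, hD⟩ := hG.exists_completion
  refine ⟨_, ⟨_, _, inferInstance, inferInstance, _, _, hC, hD, rfl⟩, ?_⟩
  refine ⟨(Unit × b) ⊕ (a × (Unit ⊕ b)), inferInstance, Sum.elim
    (fun p => F ⊗ₖ D p.2) (fun p => C p.1 ⊗ₖ (Sum.elim (fun _ : Unit => G) D p.2)), ?_⟩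
  ext1 ρ
  simp only [krausMap_apply, LinearMap.add_apply, Fintype.sum_prod_type, Fintype.sum_sum_type,
    Sum.elim_inl, Sum.elim_inr, Finset.univ_unique, Finset.sum_singleton, add_assoc]

/-- Supplies a continuation after the outcomes that were added only to complete a measurement. -/
theorem exists_isLOCC (r : ℕ) : ∀ (s : Party) (a b : Type) [Fintype a] [DecidableEq a]
    [Fintype b] [DecidableEq b], ∃ M, IsLOCC a' b' r s a b M := by
  induction r with
  | zero =>
    intro s a b _ _ _ _
    have h0 : ∀ {x y : Type} [Fintype x] [Fintype y] [DecidableEq x],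
        IsSubchannel fun _ : Unit => (0 : Matrix y x ℂ) := by
      intro x y _ _ _
      simp [IsSubchannel]
    obtain ⟨M, hM, -⟩ := exists_isLOCC_zero (a' := a') (b' := b') s (a := a) (b := b) h0 h0
    exact ⟨M, hM⟩
  | succ r ih =>
    intro s a b _ _ _ _
    cases s with
    | alice =>
      obtain ⟨P, hP⟩ := ih Party.bob a b
      exact ⟨_, a, Unit, Unit, inferInstance, inferInstance, inferInstance, inferInstance,
        fun _ _ => 1, fun _ => P, by simp [IsInstrument], fun _ => hP, rfl⟩
    | bob =>
      obtain ⟨P, hP⟩ := ih Party.alice a b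
      exact ⟨_, b, Unit, Unit, inferInstance, inferInstance, inferInstance, inferInstance,
        fun _ _ => 1, fun _ => P, by simp [IsInstrument], fun _ => hP, rfl⟩

theorem exists_isLOCC_hasBranches_empty (r : ℕ) (s : Party) (a b : Type) [Fintype a]
    [DecidableEq a] [Fintype b] [DecidableEq b] :
    ∃ M, IsLOCC a' b' r s a b M ∧ HasBranches M (fun e : Empty => e.elim) := by
  obtain ⟨M, hM⟩ := exists_isLOCC (a' := a') (b' := b') r s a b
  obtain ⟨ι, _, F, G, -, rfl⟩ := hM.exists_separable
  exact ⟨_, hM, hasBranches_empty_krausMap _⟩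

theorem exists_isLOCC_alice {r : ℕ} {a b c κ ι : Type} [Fintype a] [DecidableEq a] [Fintype b]
    [DecidableEq b] [Fintype c] [DecidableEq c] [Nonempty c] [Fintype κ] [Fintype ι]
    {K : κ → Matrix c a ℂ} (hK : IsSubchannel K) {O : κ → ι → Matrix (a' × b') (c × b) ℂ}
    (hO : ∀ k, ∃ M, IsLOCC a' b' r Party.bob c b M ∧ HasBranches M (O k)) :
    ∃ M, IsLOCC a' b' (r + 1) Party.alice a b M ∧
      HasBranches M (fun p : κ × ι => O p.1 p.2 * (K p.1 ⊗ₖ (1 : Matrix b b ℂ))) := by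
  obtain ⟨C, hC⟩ := hK.exists_completion
  choose P hP hPO using hO
  obtain ⟨Q, hQ, hQO⟩ := exists_isLOCC_hasBranches_empty (a' := a') (b' := b') r Party.bob c b
  refine ⟨_, ⟨c, κ ⊕ a, Unit, inferInstance, inferInstance, inferInstance, inferInstance,
    fun k _ => Sum.elim K C k, Sum.elim P fun _ => Q, ?_, ?_, rfl⟩,
    hasBranches_sum (K := fun k => Sum.elim K C k ⊗ₖ (1 : Matrix b b ℂ)) hPO fun _ => hQO⟩
  · simpa [IsInstrument, IsChannel] using hC
  · rintro (k | k)
    exacts [hP k, hQ]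

theorem exists_isLOCC_bob {r : ℕ} {a b c κ ι : Type} [Fintype a] [DecidableEq a] [Fintype b]
    [DecidableEq b] [Fintype c] [DecidableEq c] [Nonempty c] [Fintype κ] [Fintype ι]
    {K : κ → Matrix c b ℂ} (hK : IsSubchannel K) {O : κ → ι → Matrix (a' × b') (a × c) ℂ}
    (hO : ∀ k, ∃ M, IsLOCC a' b' r Party.alice a c M ∧ HasBranches M (O k)) :
    ∃ M, IsLOCC a' b' (r + 1) Party.bob a b M ∧
      HasBranches M (fun p : κ × ι => O p.1 p.2 * ((1 : Matrix a a ℂ) ⊗ₖ K p.1)) := by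
  obtain ⟨C, hC⟩ := hK.exists_completion
  choose P hP hPO using hO
  obtain ⟨Q, hQ, hQO⟩ := exists_isLOCC_hasBranches_empty (a' := a') (b' := b') r Party.alice a c
  refine ⟨_, ⟨c, κ ⊕ b, Unit, inferInstance, inferInstance, inferInstance, inferInstance,
    fun k _ => Sum.elim K C k, Sum.elim P fun _ => Q, ?_, ?_, rfl⟩,
    hasBranches_sum (K := fun k => (1 : Matrix a a ℂ) ⊗ₖ Sum.elim K C k) hPO fun _ => hQO⟩
  · simpa [IsInstrument, IsChannel] using hC
  · rintro (k | k)
    exacts [hP k, hQ]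

end Build

/-- Four rounds of measurements followed by local operations, the branches of which are given by
products of the local Kraus operators. -/
theorem exists_isLOCC_four {a b c₁ c₂ a' b' κ₁ κ₂ κ₃ κ₄ : Type} [Fintype a] [DecidableEq a]
    [Fintype b] [DecidableEq b] [Fintype c₁] [DecidableEq c₁] [Fintype c₂] [DecidableEq c₂]
    [Fintype a'] [DecidableEq a'] [Fintype b'] [DecidableEq b'] [Nonempty c₁] [Nonempty c₂]
    [Nonempty a'] [Nonempty b'] [Fintype κ₁] [Fintype κ₂] [Fintype κ₃] [Fintype κ₄]
    {A₁ : κ₁ → Matrix c₁ a ℂ} {B₁ : κ₁ → κ₂ → Matrix c₂ b ℂ}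
    {A₂ : κ₁ → κ₂ → κ₃ → Matrix a' c₁ ℂ} {B₂ : κ₁ → κ₂ → κ₃ → κ₄ → Matrix b' c₂ ℂ}
    {A₃ : κ₁ → κ₂ → κ₃ → κ₄ → Matrix a' a' ℂ}
    (hA₁ : IsSubchannel A₁) (hB₁ : ∀ k, IsSubchannel (B₁ k))
    (hA₂ : ∀ k l, IsSubchannel (A₂ k l)) (hB₂ : ∀ k l m, IsSubchannel (B₂ k l m))
    (hA₃ : ∀ k l m q, IsSubchannel fun _ : Unit => A₃ k l m q) :
    ∃ M, IsLOCC a' b' 4 Party.alice a b M ∧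
      HasBranches M (fun p : κ₁ × κ₂ × κ₃ × κ₄ × Unit =>
        (A₃ p.1 p.2.1 p.2.2.1 p.2.2.2.1 * A₂ p.1 p.2.1 p.2.2.1 * A₁ p.1) ⊗ₖ
          (B₂ p.1 p.2.1 p.2.2.1 p.2.2.2.1 * B₁ p.1 p.2.1)) := by
  have key := exists_isLOCC_alice (a' := a') (b' := b') hA₁ fun k =>
    exists_isLOCC_bob (hB₁ k) fun l => exists_isLOCC_alice (hA₂ k l) fun m =>
      exists_isLOCC_bob (hB₂ k l m) fun q =>
        exists_isLOCC_zero Party.alice (hA₃ k l m q)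
          (show IsSubchannel fun _ : Unit => (1 : Matrix b' b' ℂ) by simp [IsSubchannel])
  simpa only [← Matrix.mul_kronecker_mul, Matrix.mul_one, Matrix.one_mul] using key

/-- The fidelity with a pure target is a sum of nonnegative terms, one for each Kraus operator, so
the unlisted branches can only help. -/
theorem HasBranches.le_fidelity {x y R κ : Type} [Fintype x] [Fintype y] [DecidableEq y]
    [Fintype R] [DecidableEq R] [Fintype κ] {M : Matrix x x ℂ →ₗ[ℂ] Matrix y y ℂ}
    {O : κ → Matrix y x ℂ} (h : HasBranches M O) (ψ : x × R → ℂ) (t : y × R → ℂ) :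
    ∑ k, ‖star t ⬝ᵥ localAct (O k) ψ‖ ^ 2 ≤
      fidelity (withReference M (pureState ψ)) (pureState t) := by
  obtain ⟨ι, _, C, rfl⟩ := h
  rw [← krausMap_sumElim, fidelity_krausMap, Fintype.sum_sum_type]
  exact le_add_of_nonneg_right (Finset.sum_nonneg fun _ _ => by positivity)

/-! ### Overlaps of vectors of bounded Schmidt rank -/

theorem norm_sum_mul_sq_le {ι : Type} [Fintype ι] (f g : ι → ℂ) :
    ‖∑ i, f i * g i‖ ^ 2 ≤ (∑ i, ‖f i‖ ^ 2) * ∑ i, ‖g i‖ ^ 2 := by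
  calc ‖∑ i, f i * g i‖ ^ 2 ≤ (∑ i, ‖f i‖ * ‖g i‖) ^ 2 := by
        gcongr
        exact (norm_sum_le _ _).trans_eq (by simp only [norm_mul])
    _ ≤ _ := Finset.sum_mul_sq_le_sq_mul_sq _ _ _

/-- A bipartite vector of Schmidt rank at most `K` has overlap at most `K c` with a vector all of
whose Schmidt coefficients are at most `c`. -/
theorem norm_overlap_sq_le_of_schmidtRank {m n : Type} [Fintype m] [Fintype n] {K : ℕ}
    (X : Fin K → m → ℂ) (Y : Fin K → n → ℂ) (T : m → n → ℂ) {c : ℝ} (hc : 0 ≤ c)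
    (hT : ∀ u : m → ℂ, ∑ j, ‖∑ i, star (T i j) * u i‖ ^ 2 ≤ c * ∑ i, ‖u i‖ ^ 2) :
    ‖∑ i, ∑ j, star (T i j) * ∑ k, X k i * Y k j‖ ^ 2 ≤
      K * c * ∑ i, ∑ j, ‖∑ k, X k i * Y k j‖ ^ 2 := by
  -- The columns lie in the span V of the X k, of dimension at most K. In an orthonormal basis of V
  -- the overlap is an inner product of coefficients with images of basis vectors under T†; each of
  -- these images has squared norm at most c, and Cauchy–Schwarz concludes.
  let φ : n → EuclideanSpace ℂ m := fun j => WithLp.toLp 2 fun i => ∑ k, X k i * Y k j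
  let V : Submodule ℂ (EuclideanSpace ℂ m) :=
    Submodule.span ℂ (Set.range fun k : Fin K => WithLp.toLp 2 (X k))
  have hφ : ∀ j, φ j ∈ V := by
    intro j
    have : φ j = ∑ k, Y k j • WithLp.toLp 2 (X k) := by
      ext i
      simp [φ, mul_comm]
    rw [this]
    exact Submodule.sum_mem _ fun k _ =>
      Submodule.smul_mem _ _ (Submodule.subset_span (Set.mem_range_self k))
  have hdim : Module.finrank ℂ V ≤ K := by
    have := finrank_range_le_card (R := ℂ) fun k : Fin K =>
      (WithLp.toLp 2 (X k) : EuclideanSpace ℂ m)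
    rwa [Fintype.card_fin] at this
  let b := stdOrthonormalBasis ℂ V
  let d : Fin (Module.finrank ℂ V) → EuclideanSpace ℂ m := fun i => (b i : EuclideanSpace ℂ m)
  let p : Fin (Module.finrank ℂ V) → n → ℂ := fun i j => inner ℂ (b i) (⟨φ j, hφ j⟩ : V)
  have hrep : ∀ i j, (∑ k, X k i * Y k j) = ∑ a, p a j * d a i := by
    intro i j
    have h1 := congrArg (fun v : V => (v : EuclideanSpace ℂ m) i) (b.sum_repr' ⟨φ j, hφ j⟩)
    simp only [Submodule.coe_sum, Submodule.coe_smul, WithLp.ofLp_sum, Finset.sum_apply,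
      WithLp.ofLp_smul, Pi.smul_apply, smul_eq_mul] at h1
    exact h1.symm
  have hnorm : ∀ j, ∑ a, ‖p a j‖ ^ 2 = ∑ i, ‖∑ k, X k i * Y k j‖ ^ 2 := by
    intro j
    have h1 := b.sum_sq_norm_inner_right ⟨φ j, hφ j⟩
    rw [h1]
    exact EuclideanSpace.norm_sq_eq (φ j)
  have hd : ∀ a, ∑ i, ‖d a i‖ ^ 2 = 1 := by
    intro a
    rw [← EuclideanSpace.norm_sq_eq (d a)]
    have : ‖d a‖ = 1 := b.orthonormal.1 a
    rw [this, one_pow]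
  have hsum : ∑ i, ∑ j, star (T i j) * ∑ k, X k i * Y k j =
      ∑ q : _ × n, p q.1 q.2 * ∑ i, star (T i q.2) * d q.1 i := by
    calc _ = ∑ i, ∑ j, ∑ a, p a j * (star (T i j) * d a i) := by
          simp only [hrep, Finset.mul_sum]
          refine Finset.sum_congr rfl fun i _ => Finset.sum_congr rfl fun j _ =>
            Finset.sum_congr rfl fun a _ => by ring
      _ = ∑ j, ∑ a, ∑ i, p a j * (star (T i j) * d a i) := by
          rw [Finset.sum_comm]
          exact Finset.sum_congr rfl fun j _ => Finset.sum_comm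
      _ = _ := by
          rw [Finset.sum_comm, Fintype.sum_prod_type]
          simp only [Finset.mul_sum]
  have hp : ∑ q : _ × n, ‖p q.1 q.2‖ ^ 2 = ∑ i, ∑ j, ‖∑ k, X k i * Y k j‖ ^ 2 := by
    rw [Fintype.sum_prod_type, Finset.sum_comm]
    simp only [hnorm]
    exact Finset.sum_comm
  have hTd : ∑ q : Fin (Module.finrank ℂ V) × n, ‖∑ i, star (T i q.2) * d q.1 i‖ ^ 2 ≤ K * c := by
    rw [Fintype.sum_prod_type]
    calc _ ≤ ∑ a : Fin (Module.finrank ℂ V), c :=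
          Finset.sum_le_sum fun a _ => by simpa [hd] using hT (d a)
      _ = (Module.finrank ℂ V : ℝ) * c := by simp
      _ ≤ K * c := by gcongr
  rw [hsum]
  refine (norm_sum_mul_sq_le _ _).trans ?_
  rw [hp, mul_comm]
  gcongr

theorem sum_norm_sq_localAct {x y ι R : Type} [Fintype x] [Fintype y] [DecidableEq x] [Fintype ι]
    [Fintype R] {K : ι → Matrix y x ℂ} (hK : IsChannel K) (ψ : x × R → ℂ) :
    ∑ i, ∑ q, ‖localAct (K i) ψ q‖ ^ 2 = ∑ q, ‖ψ q‖ ^ 2 := by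
  have hsq : ∀ {z : Type} [Fintype z] (v : z → ℂ),
      ((∑ i, ‖v i‖ ^ 2 : ℝ) : ℂ) = star v ⬝ᵥ v := by
    intro z _ v
    simp [dotProduct, Complex.conj_mul']
  have key : ∀ r : R, ∑ i, ∑ p, ‖localAct (K i) ψ (p, r)‖ ^ 2 = ∑ a, ‖ψ (a, r)‖ ^ 2 := by
    intro r
    apply Complex.ofReal_injective
    rw [Complex.ofReal_sum]
    simp only [hsq]
    set v : x → ℂ := fun a => ψ (a, r) with hv
    have : ∀ i, (fun p => localAct (K i) ψ (p, r)) = K i *ᵥ v := fun i => rfl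
    simp only [this, Matrix.star_mulVec]
    simp only [← Matrix.dotProduct_mulVec, Matrix.mulVec_mulVec]
    rw [← dotProduct_sum, ← Matrix.sum_mulVec, show ∑ i, (K i)ᴴ * K i = 1 from hK,
      Matrix.one_mulVec]
  simp only [Fintype.sum_prod_type_right]
  rw [Finset.sum_comm]
  exact Finset.sum_congr rfl fun r _ => key r

/-! ### The input and target vectors -/

theorem maxEnt_prod (d : ℕ) {n : ℕ} (x r : Fin n → Fin d) :
    ∏ i, maxEnt d (x i) (r i) = if x = r then ((((Real.sqrt d)⁻¹ : ℝ) : ℂ)) ^ n else 0 := by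
  split_ifs with h
  · subst h
    simp [maxEnt]
  · obtain ⟨i, hi⟩ := Function.ne_iff.1 h
    exact Finset.prod_eq_zero (Finset.mem_univ i) (by simp [maxEnt, hi])

theorem sum_sum_maxEnt_sq {d : ℕ} (hd : 1 ≤ d) : ∑ i, ∑ j, ‖maxEnt d i j‖ ^ 2 = 1 := by
  have hd' : (d : ℝ) ≠ 0 := by positivity
  have h : ∀ i j : Fin d, ‖maxEnt d i j‖ ^ 2 = if i = j then (d : ℝ)⁻¹ else 0 := by
    intro i j
    unfold maxEnt
    split_ifs
    · rw [Complex.norm_real, Real.norm_of_nonneg (by positivity), inv_pow,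
        Real.sq_sqrt (by positivity)]
    · simp
  simp [h, hd']

theorem sum_prod_maxEnt_sq {d : ℕ} (hd : 1 ≤ d) (n : ℕ) :
    ∑ x : Fin n → Fin d, ∑ r : Fin n → Fin d, ‖∏ i, maxEnt d (x i) (r i)‖ ^ 2 = 1 := by
  have h := Fintype.sum_pow (fun q : Fin d × Fin d => ‖maxEnt d q.1 q.2‖ ^ 2) n
  rw [Fintype.sum_prod_type, sum_sum_maxEnt_sq hd, one_pow] at h
  rw [h, ← Fintype.sum_prod_type (f := fun q : (Fin n → Fin d) × (Fin n → Fin d) =>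
    ‖∏ i, maxEnt d (q.1 i) (q.2 i)‖ ^ 2)]
  refine Fintype.sum_equiv (Equiv.arrowProdEquivProdArrow _ _ _).symm _ _ fun q => ?_
  simp [norm_prod, Finset.prod_pow, Equiv.arrowProdEquivProdArrow]

theorem sum_norm_sq_inputVec {d : ℕ} (hd : 1 ≤ d) (n : ℕ) {K : ℕ} (hK : 1 ≤ K) :
    ∑ p, ‖inputVec d n K p‖ ^ 2 = 1 := by
  have h1 := sum_prod_maxEnt_sq hd n
  have h2 := sum_sum_maxEnt_sq hK
  calc _ = ∑ x : Fin n → Fin d, ∑ κ : Fin K, ∑ y : Fin n → Fin d, ∑ κ' : Fin K,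
        ∑ r : Fin n → Fin d, ∑ r' : Fin n → Fin d,
          ‖∏ i, maxEnt d (x i) (r i)‖ ^ 2 * ‖∏ i, maxEnt d (y i) (r' i)‖ ^ 2 *
            ‖maxEnt K κ κ'‖ ^ 2 := by
        simp only [Fintype.sum_prod_type, inputVec, norm_mul, mul_pow]
    _ = (∑ x : Fin n → Fin d, ∑ r : Fin n → Fin d, ‖∏ i, maxEnt d (x i) (r i)‖ ^ 2) *
          (∑ y : Fin n → Fin d, ∑ r' : Fin n → Fin d, ‖∏ i, maxEnt d (y i) (r' i)‖ ^ 2) *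
          (∑ κ : Fin K, ∑ κ' : Fin K, ‖maxEnt K κ κ'‖ ^ 2) := by
        simp only [← Finset.mul_sum, ← Finset.sum_mul]
    _ = 1 := by rw [h1, h2]; norm_num

/-- The diagonal entries of the gate. -/
noncomputable def gatePhase (θ : ℝ) (x y : Fin 2) : ℂ :=
  if x = 0 then 1 else Complex.exp (((if y = 0 then θ else -θ : ℝ) : ℂ) * Complex.I)

theorem norm_gatePhase (θ : ℝ) (x y : Fin 2) : ‖gatePhase θ x y‖ = 1 := by
  unfold gatePhase
  split_ifs
  · simp
  · exact Complex.norm_exp_ofReal_mul_I _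
  · exact Complex.norm_exp_ofReal_mul_I _

theorem gate_eq_diagonal (θ : ℝ) :
    gate θ = Matrix.diagonal fun p => gatePhase θ p.1 p.2 := by
  have h1 : (Complex.I * (θ : ℂ)) • sigmaZ =
      Matrix.diagonal ![(θ : ℂ) * Complex.I, -(θ : ℂ) * Complex.I] := by
    ext i j
    fin_cases i <;> fin_cases j <;> simp [sigmaZ, mul_comm]
  have h2 : NormedSpace.exp ((Complex.I * (θ : ℂ)) • sigmaZ) =
      Matrix.diagonal ![Complex.exp ((θ : ℂ) * Complex.I), Complex.exp (-(θ : ℂ) * Complex.I)] := by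
    rw [h1, Matrix.exp_diagonal]
    congr 1
    funext i
    rw [Pi.coe_exp, ← Complex.exp_eq_exp_ℂ]
    fin_cases i <;> simp
  rw [gate, h2]
  ext ⟨x, y⟩ ⟨x', y'⟩
  fin_cases x <;> fin_cases y <;> fin_cases x' <;> fin_cases y' <;>
    simp [gatePhase, Matrix.kroneckerMap_apply]

theorem targetVec_gate (θ : ℝ) (n L : ℕ) (p : (Lab 2 n L × Lab 2 n L) × Refs 2 n) :
    targetVec (gate θ) n L p =
      (∏ i, gatePhase θ (p.1.1.1 i) (p.1.2.1 i)) * inputVec 2 n L p := by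
  simp only [targetVec, inputVec, gateState, gate_eq_diagonal, Matrix.mulVec_diagonal,
    Finset.prod_mul_distrib]
  ring

/-! ### The overlap achieved with entanglement `K` -/

theorem localAct_kronecker_inputVec {d n K : ℕ} {a' b' : Type} (F : Matrix a' (Lab d n K) ℂ)
    (G : Matrix b' (Lab d n K) ℂ) (p : a') (q : b') (r r' : Fin n → Fin d) :
    localAct (F ⊗ₖ G) (inputVec d n K) ((p, q), (r, r')) =
      ∑ κ, ((((Real.sqrt K)⁻¹ : ℝ) : ℂ) * ∑ x, F p (x, κ) * ∏ i, maxEnt d (x i) (r i)) *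
        ∑ y, G q (y, κ) * ∏ i, maxEnt d (y i) (r' i) := by
  calc _ = ∑ x : Fin n → Fin d, ∑ κ : Fin K, ∑ y : Fin n → Fin d,
        ((((Real.sqrt K)⁻¹ : ℝ) : ℂ) * (F p (x, κ) * ∏ i, maxEnt d (x i) (r i))) *
          (G q (y, κ) * ∏ i, maxEnt d (y i) (r' i)) := by
        simp only [localAct, Fintype.sum_prod_type, Matrix.kroneckerMap_apply, inputVec]
        refine Finset.sum_congr rfl fun x _ => Finset.sum_congr rfl fun κ _ =>
          Finset.sum_congr rfl fun y _ => ?_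
        rw [Finset.sum_eq_single κ]
        · simp only [maxEnt, if_true]
          ring
        · intro κ' _ h
          simp [maxEnt, h.symm]
        · simp
    _ = _ := by
        rw [Finset.sum_comm]
        refine Finset.sum_congr rfl fun κ _ => ?_
        rw [← Finset.sum_mul_sum, ← Finset.mul_sum]

/-- The factor Φ_L alone caps the squared Schmidt coefficients of ψ ⊗ Φ_L at 1/L, however little ψ
is entangled: each l meets only itself, with weight L⁻¹, and the remaining sum is Cauchy–Schwarz
with ‖ψ‖ = 1. -/
theorem sum_norm_sq_overlap_maxEnt_le {z z' : Type} [Fintype z] [Fintype z'] {L : ℕ}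
    (ψ : z → z' → ℂ) (hψ : ∑ i, ∑ j, ‖ψ i j‖ ^ 2 = 1) (u : z × Fin L → ℂ) :
    ∑ q : z' × Fin L, ‖∑ p : z × Fin L, star (ψ p.1 q.1 * maxEnt L p.2 q.2) * u p‖ ^ 2 ≤
      (L : ℝ)⁻¹ * ∑ p, ‖u p‖ ^ 2 := by
  have h : ∀ (j : z') (l : Fin L), ‖∑ p : z × Fin L, star (ψ p.1 j * maxEnt L p.2 l) * u p‖ ^ 2 ≤
      (L : ℝ)⁻¹ * ((∑ i, ‖ψ i j‖ ^ 2) * ∑ i, ‖u (i, l)‖ ^ 2) := by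
    intro j l
    have : ∑ p : z × Fin L, star (ψ p.1 j * maxEnt L p.2 l) * u p =
        (((Real.sqrt L)⁻¹ : ℝ) : ℂ) * ∑ i, star (ψ i j) * u (i, l) := by
      rw [Fintype.sum_prod_type, Finset.mul_sum]
      refine Finset.sum_congr rfl fun i _ => ?_
      rw [Finset.sum_eq_single l]
      · simp only [maxEnt, if_true, star_mul', RCLike.star_def, Complex.conj_ofReal]
        ring
      · intro l' _ h
        simp [maxEnt, h]
      · simp
    rw [this, norm_mul, mul_pow, Complex.norm_real, Real.norm_of_nonneg (by positivity), inv_pow,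
      Real.sq_sqrt (by positivity)]
    gcongr
    refine (norm_sum_mul_sq_le _ _).trans_eq ?_
    simp only [norm_star]
  rw [Fintype.sum_prod_type]
  refine (Finset.sum_le_sum fun j _ => Finset.sum_le_sum fun l _ => h j l).trans_eq ?_
  simp only [← Finset.mul_sum]
  rw [← Finset.sum_mul, Finset.sum_comm, hψ, one_mul, Finset.sum_comm, Fintype.sum_prod_type]

/-- No LOCC map turns `Φ_K` into a vector of `n` gates and `Φ_L` with a fidelity larger than
`K / L`. -/
theorem fidelity_le_of_isLOCC {θ : ℝ} {r n K L : ℕ} (hK : 1 ≤ K) {s : Party}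
    {M : Matrix (Lab 2 n K × Lab 2 n K) (Lab 2 n K × Lab 2 n K) ℂ →ₗ[ℂ]
      Matrix (Lab 2 n L × Lab 2 n L) (Lab 2 n L × Lab 2 n L) ℂ}
    (hM : IsLOCC (Lab 2 n L) (Lab 2 n L) r s (Lab 2 n K) (Lab 2 n K) M) :
    fidelity (withReference M (pureState (inputVec 2 n K)))
      (pureState (targetVec (gate θ) n L)) ≤ K / L := by
  obtain ⟨ι, _, F, G, hFG, rfl⟩ := hM.exists_separable
  rw [fidelity_krausMap]
  let ψ : (Fin n → Fin 2) × (Fin n → Fin 2) → (Fin n → Fin 2) × (Fin n → Fin 2) → ℂ :=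
    fun p q => (∏ i, gatePhase θ (p.1 i) (q.1 i)) *
      ((∏ i, maxEnt 2 (p.1 i) (p.2 i)) * ∏ i, maxEnt 2 (q.1 i) (q.2 i))
  have hψ : ∑ p, ∑ q, ‖ψ p q‖ ^ 2 = 1 := by
    have h1 := sum_prod_maxEnt_sq (d := 2) (by norm_num) n
    simp only [ψ, norm_mul, norm_prod, norm_gatePhase, Finset.prod_const_one, one_mul, mul_pow]
    simp only [norm_prod] at h1
    rw [← Finset.sum_mul_sum, Fintype.sum_prod_type, h1, one_mul]
  -- The Schmidt rank is taken across the cut that gives each party its own reference system.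
  let e : ∀ k : ℕ, (Lab 2 n k × Lab 2 n k) × Refs 2 n ≃
      (((Fin n → Fin 2) × (Fin n → Fin 2)) × Fin k) ×
        (((Fin n → Fin 2) × (Fin n → Fin 2)) × Fin k) := fun k =>
    { toFun := fun p => (((p.1.1.1, p.2.1), p.1.1.2), ((p.1.2.1, p.2.2), p.1.2.2))
      invFun := fun q => (((q.1.1.1, q.1.2), (q.2.1.1, q.2.2)), (q.1.1.2, q.2.1.2))
      left_inv := fun p => rfl
      right_inv := fun q => rfl }
  have hbound : ∀ i, ‖star (targetVec (gate θ) n L) ⬝ᵥ localAct (F i ⊗ₖ G i) (inputVec 2 n K)‖ ^ 2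
      ≤ K * (L : ℝ)⁻¹ * ∑ q, ‖localAct (F i ⊗ₖ G i) (inputVec 2 n K) q‖ ^ 2 := by
    intro i
    have key := norm_overlap_sq_le_of_schmidtRank
      (m := ((Fin n → Fin 2) × (Fin n → Fin 2)) × Fin L)
      (n := ((Fin n → Fin 2) × (Fin n → Fin 2)) × Fin L) (K := K)
      (fun κ p => (((Real.sqrt K)⁻¹ : ℝ) : ℂ) *
        ∑ x, F i (p.1.1, p.2) (x, κ) * ∏ i, maxEnt 2 (x i) (p.1.2 i))
      (fun κ q => ∑ y, G i (q.1.1, q.2) (y, κ) * ∏ i, maxEnt 2 (y i) (q.1.2 i))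
      (fun p q => ψ p.1 q.1 * maxEnt L p.2 q.2) (c := (L : ℝ)⁻¹) (by positivity)
      (sum_norm_sq_overlap_maxEnt_le ψ hψ)
    simp only [← localAct_kronecker_inputVec] at key
    rw [← Fintype.sum_prod_type (f := fun q : (((Fin n → Fin 2) × (Fin n → Fin 2)) × Fin L) ×
      (((Fin n → Fin 2) × (Fin n → Fin 2)) × Fin L) => ‖localAct (F i ⊗ₖ G i) (inputVec 2 n K)
        (((q.1.1.1, q.1.2), (q.2.1.1, q.2.2)), (q.1.1.2, q.2.1.2))‖ ^ 2),
      ← Fintype.sum_prod_type (f := fun q : (((Fin n → Fin 2) × (Fin n → Fin 2)) × Fin L) ×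
      (((Fin n → Fin 2) × (Fin n → Fin 2)) × Fin L) => star (ψ q.1.1 q.2.1 * maxEnt L q.1.2 q.2.2) *
        localAct (F i ⊗ₖ G i) (inputVec 2 n K)
        (((q.1.1.1, q.1.2), (q.2.1.1, q.2.2)), (q.1.1.2, q.2.1.2)))] at key
    rw [← (e L).sum_comp, ← (e L).sum_comp] at key
    refine le_of_eq_of_le ?_ key
    congr 2
    refine Finset.sum_congr rfl fun p _ => ?_
    simp only [e, Equiv.coe_fn_mk, Pi.star_apply, targetVec_gate, inputVec, ψ]
    congr 2
    ring
  calc _ ≤ ∑ i, K * (L : ℝ)⁻¹ * ∑ q, ‖localAct (F i ⊗ₖ G i) (inputVec 2 n K) q‖ ^ 2 :=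
        Finset.sum_le_sum fun i _ => hbound i
    _ = K / L := by
        rw [← Finset.mul_sum, sum_norm_sq_localAct hFG, sum_norm_sq_inputVec (by norm_num) n hK,
          mul_one, div_eq_mul_inv]

/-! ### Large deviations -/

/-- Chernoff's bound: the moment generating function g equals 1 at 0 with derivative the mean, which
is negative, so g t < 1 for some t > 0, and exp(t ∑ f) dominates the indicator of the event. -/
theorem exists_pow_bound_sum_prod {α : Type} [Fintype α] {P f : α → ℝ} (hP : ∀ a, 0 ≤ P a)
    (hsum : ∑ a, P a = 1) (hneg : ∑ a, P a * f a < 0) :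
    ∃ ρ : ℝ, 0 ≤ ρ ∧ ρ < 1 ∧ ∀ n : ℕ,
      ∑ x : Fin n → α with 0 ≤ ∑ i, f (x i), ∏ i, P (x i) ≤ ρ ^ n := by
  classical
  let g : ℝ → ℝ := fun t => ∑ a, P a * Real.exp (t * f a)
  have hg : HasDerivAt g (∑ a, P a * f a) 0 := by
    refine HasDerivAt.fun_sum fun a _ => ?_
    have h1 : HasDerivAt (fun t : ℝ => t * f a) (f a) 0 := by
      simpa using (hasDerivAt_id (0 : ℝ)).mul_const (f a)
    simpa using h1.exp.const_mul (P a)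
  have hg0 : g 0 = 1 := by simp [g, hsum]
  obtain ⟨t, ht, hgt⟩ : ∃ t : ℝ, 0 < t ∧ g t < 1 := by
    have h1 := (hasDerivAt_iff_tendsto_slope_zero.1 hg).mono_left
      (nhdsWithin_mono (0 : ℝ) fun x (hx : x ∈ Set.Ioi 0) => (ne_of_gt hx : x ≠ 0))
    obtain ⟨t, h2, ht⟩ := ((h1.eventually (eventually_lt_nhds hneg)).and
      self_mem_nhdsWithin).exists
    have ht' : 0 < t := ht
    refine ⟨t, ht', ?_⟩
    rw [zero_add, hg0, smul_eq_mul, inv_mul_eq_div, div_lt_iff₀ ht', zero_mul] at h2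
    linarith
  refine ⟨g t, Finset.sum_nonneg fun a _ => mul_nonneg (hP a) (Real.exp_pos _).le, hgt,
    fun n => ?_⟩
  calc _ ≤ ∑ x : Fin n → α with 0 ≤ ∑ i, f (x i), ∏ i, P (x i) * Real.exp (t * f (x i)) := by
        refine Finset.sum_le_sum fun x hx => ?_
        rw [Finset.prod_mul_distrib, ← Real.exp_sum, ← Finset.mul_sum]
        refine le_mul_of_one_le_right (Finset.prod_nonneg fun i _ => hP _)
          (Real.one_le_exp (mul_nonneg ht.le (Finset.mem_filter.1 hx).2))
    _ ≤ ∑ x : Fin n → α, ∏ i, P (x i) * Real.exp (t * f (x i)) :=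
        Finset.sum_le_univ_sum_of_nonneg fun x =>
          Finset.prod_nonneg fun i _ => mul_nonneg (hP _) (Real.exp_pos _).le
    _ = g t ^ n := (Fintype.sum_pow (fun a => P a * Real.exp (t * f a)) n).symm

/-- Let q be the marginal weight of s and D the part of it lost outside T. The inner sum is (q -
D)/√q, whose square is at least q - 2D; summing over s costs at most twice the probability of the
complement of T. -/
theorem one_sub_le_sum_sq_sum_prod {α β : Type} [Fintype α] [Fintype β] [DecidableEq α]
    [DecidableEq β]
    {J : α → β → ℝ} (hJ : ∀ a b, 0 ≤ J a b) (hpos : ∀ a, 0 < ∑ b, J a b)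
    (hsum : ∑ a, ∑ b, J a b = 1) {n : ℕ} (S : Finset (Fin n → α)) (T : Finset (Fin n → β)) :
    1 - ∑ s ∈ Sᶜ, ∏ i, ∑ b, J (s i) b - 2 * ∑ w ∈ Tᶜ, ∏ i, ∑ a, J a (w i) ≤
      ∑ s ∈ S, (∑ w ∈ T, ∏ i, J (s i) (w i) / Real.sqrt (∑ b, J (s i) b)) ^ 2 := by
  let q : (Fin n → α) → ℝ := fun s => ∏ i, ∑ b, J (s i) b
  let A : (Fin n → α) → ℝ := fun s => ∑ w ∈ T, ∏ i, J (s i) (w i)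
  let D : (Fin n → α) → ℝ := fun s => ∑ w ∈ Tᶜ, ∏ i, J (s i) (w i)
  have hq : ∀ s, 0 < q s := fun s => Finset.prod_pos fun i _ => hpos _
  have hAD : ∀ s, A s + D s = q s := by
    intro s
    simp only [A, D, q]
    rw [Finset.sum_add_sum_compl, Finset.prod_univ_sum, Fintype.piFinset_univ]
  have hD : ∀ s, 0 ≤ D s := fun s =>
    Finset.sum_nonneg fun w _ => Finset.prod_nonneg fun i _ => hJ _ _
  have hDs : ∑ s, D s = ∑ w ∈ Tᶜ, ∏ i, ∑ a, J a (w i) := by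
    simp only [D]
    rw [Finset.sum_comm]
    refine Finset.sum_congr rfl fun w _ => ?_
    rw [Finset.prod_univ_sum, Fintype.piFinset_univ]
  have hqs : ∑ s ∈ S, q s = 1 - ∑ s ∈ Sᶜ, q s := by
    rw [eq_sub_iff_add_eq, Finset.sum_add_sum_compl]
    have := Fintype.sum_pow (fun a => ∑ b, J a b) n
    rw [hsum, one_pow] at this
    exact this.symm
  have hterm : ∀ s, q s - 2 * D s ≤
      (∑ w ∈ T, ∏ i, J (s i) (w i) / Real.sqrt (∑ b, J (s i) b)) ^ 2 := by
    intro s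
    have h1 : ∑ w ∈ T, ∏ i, J (s i) (w i) / Real.sqrt (∑ b, J (s i) b) =
        A s / Real.sqrt (q s) := by
      simp only [A, q, Finset.sum_div, Finset.prod_div_distrib]
      rw [Real.sqrt_prod _ fun i _ => (hpos _).le]
    rw [h1, div_pow, Real.sq_sqrt (hq s).le, le_div_iff₀ (hq s)]
    rw [show A s = q s - D s from eq_sub_of_add_eq (hAD s)]
    nlinarith [sq_nonneg (D s)]
  calc _ = ∑ s ∈ S, q s - 2 * ∑ s, D s := by rw [hqs, hDs]
    _ ≤ ∑ s ∈ S, q s - 2 * ∑ s ∈ S, D s := by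
        have := Finset.sum_le_univ_sum_of_nonneg (s := S) hD
        linarith
    _ = ∑ s ∈ S, (q s - 2 * D s) := by rw [Finset.sum_sub_distrib, Finset.mul_sum]
    _ ≤ _ := Finset.sum_le_sum fun s _ => hterm s

theorem two_rpow_sum_logb {n : ℕ} {β : Type} {P : β → ℝ} (hP : ∀ b, 0 < P b) (w : Fin n → β) :
    (2 : ℝ) ^ (∑ i, Real.logb 2 (P (w i))) = ∏ i, P (w i) := by
  rw [Real.rpow_sum_of_pos (by norm_num)]
  exact Finset.prod_congr rfl fun i _ => Real.rpow_logb (by norm_num) (by norm_num) (hP _)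

/-- The number of sequences that are likelier than `2 ^ (-n c)`. -/
theorem card_typical_le {n : ℕ} {β : Type} [Fintype β] [DecidableEq β] {P : β → ℝ}
    (hP : ∀ b, 0 < P b) (hsum : ∑ b, P b = 1) (c : ℝ) :
    ((Finset.univ.filter fun w : Fin n → β => ¬ 0 ≤ ∑ i, (-Real.logb 2 (P (w i)) - c)).card : ℝ) ≤
      2 ^ (n * c) := by
  set T := Finset.univ.filter fun w : Fin n → β => ¬ 0 ≤ ∑ i, (-Real.logb 2 (P (w i)) - c)
  -- Each member of T has probability at least 2^(-nc), and the probabilities sum to at most 1.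
  have h1 : (T.card : ℝ) * 2 ^ (-(n * c)) ≤ 1 := by
    calc (T.card : ℝ) * 2 ^ (-(n * c)) = ∑ w ∈ T, (2 : ℝ) ^ (-(n * c)) := by simp
      _ ≤ ∑ w ∈ T, ∏ i, P (w i) := by
          refine Finset.sum_le_sum fun w hw => ?_
          rw [← two_rpow_sum_logb hP]
          refine Real.rpow_le_rpow_of_exponent_le (by norm_num) ?_
          have := not_le.1 (Finset.mem_filter.1 hw).2
          simp only [Finset.sum_sub_distrib, Finset.sum_neg_distrib, Finset.sum_const,
            Finset.card_univ, Fintype.card_fin, nsmul_eq_mul] at this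
          linarith
      _ ≤ ∑ w : Fin n → β, ∏ i, P (w i) :=
          Finset.sum_le_univ_sum_of_nonneg fun w => Finset.prod_nonneg fun i _ => (hP _).le
      _ = 1 := by rw [← Fintype.sum_pow, hsum, one_pow]
  rwa [Real.rpow_neg (by norm_num), mul_inv_le_iff₀ (by positivity), one_mul] at h1

/-! ### Controlled operators -/

section Controlled

variable {X p q r κ : Type} [DecidableEq X]

/-- The operator `∑ x, |x⟩⟨x| ⊗ f x`. -/
def controlled (f : X → Matrix p q ℂ) : Matrix (X × p) (X × q) ℂ :=
  Matrix.of fun i j => if i.1 = j.1 then f i.1 i.2 j.2 else 0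

theorem controlled_apply (f : X → Matrix p q ℂ) (i : X × p) (j : X × q) :
    controlled f i j = if i.1 = j.1 then f i.1 i.2 j.2 else 0 := rfl

theorem controlled_mul [Fintype X] [Fintype q] (f : X → Matrix p q ℂ) (g : X → Matrix q r ℂ) :
    controlled f * controlled g = controlled fun x => f x * g x := by
  ext ⟨x, i⟩ ⟨y, j⟩
  simp only [Matrix.mul_apply, controlled_apply, Fintype.sum_prod_type]
  rw [Finset.sum_eq_single x]
  · by_cases h : x = y <;> simp [h]
  · intro z _ h
    simp [h.symm]
  · simp

theorem controlled_conjTranspose (f : X → Matrix p q ℂ) :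
    (controlled f)ᴴ = controlled fun x => (f x)ᴴ := by
  ext ⟨x, i⟩ ⟨y, j⟩
  by_cases h : x = y
  · subst h
    simp [controlled_apply]
  · simp [controlled_apply, h, Ne.symm h]

theorem sum_controlled [Fintype κ] (f : κ → X → Matrix p q ℂ) :
    ∑ k, controlled (f k) = controlled fun x => ∑ k, f k x := by
  ext ⟨x, i⟩ ⟨y, j⟩
  by_cases h : x = y <;> simp [controlled_apply, Matrix.sum_apply, h]

theorem one_sub_controlled [DecidableEq q] (f : X → Matrix q q ℂ) :
    1 - controlled f = controlled fun x => 1 - f x := by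
  ext ⟨x, i⟩ ⟨y, j⟩
  by_cases h : x = y <;> simp [controlled_apply, Matrix.one_apply, h]

/-- The defect is block diagonal, and the square roots of its blocks exhibit it as X†X. -/
theorem isSubchannel_controlled [Fintype X] [Fintype p] [Fintype q] [DecidableEq q] [Fintype κ]
    {f : κ → X → Matrix p q ℂ} (hf : ∀ x, IsSubchannel fun k => f k x) :
    IsSubchannel fun k => controlled (f k) := by
  simp only [IsSubchannel, controlled_conjTranspose, controlled_mul, sum_controlled]
  rw [← sub_nonneg, one_sub_controlled]
  have h : ∀ x, 0 ≤ 1 - ∑ k, (f k x)ᴴ * f k x := fun x => sub_nonneg.2 (hf x)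
  have h2 : (controlled fun x => 1 - ∑ k, (f k x)ᴴ * f k x) =
      (controlled fun x => CFC.sqrt (1 - ∑ k, (f k x)ᴴ * f k x))ᴴ *
        controlled fun x => CFC.sqrt (1 - ∑ k, (f k x)ᴴ * f k x) := by
    rw [controlled_conjTranspose, controlled_mul]
    congr 1
    funext x
    rw [show (CFC.sqrt (1 - ∑ k, (f k x)ᴴ * f k x))ᴴ = CFC.sqrt (1 - ∑ k, (f k x)ᴴ * f k x) from
      (CFC.sqrt_nonneg _).isSelfAdjoint, CFC.sqrt_mul_sqrt_self _ (h x)]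
  rw [h2]
  exact (Matrix.posSemidef_conjTranspose_mul_self _).nonneg

end Controlled

/-! ### Row and embedding operators -/

/-- The operator `γ ⊗ 1`, with `γ` a row vector. -/
def rowOp {W Q : Type} [DecidableEq Q] (γ : W → ℂ) : Matrix Q (W × Q) ℂ :=
  Matrix.of fun q i => if q = i.2 then γ i.1 else 0

theorem sum_rowOp_conjTranspose_mul_self {W Q κ : Type} [DecidableEq W] [Fintype Q]
    [DecidableEq Q] [Fintype κ] (γ : κ → W → ℂ) (d : W → ℂ)
    (h : ∀ w w', ∑ k, star (γ k w) * γ k w' = if w = w' then d w else 0) :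
    ∑ k, (rowOp (Q := Q) (γ k))ᴴ * rowOp (Q := Q) (γ k) =
      Matrix.diagonal fun i : W × Q => d i.1 := by
  ext ⟨w, q⟩ ⟨w', q'⟩
  simp only [Matrix.sum_apply, Matrix.mul_apply, Matrix.conjTranspose_apply, rowOp,
    Matrix.of_apply, Matrix.diagonal_apply, Prod.mk.injEq]
  by_cases hq : q = q'
  · subst hq
    simpa using h w w'
  · have : ∀ k, ∑ x : Q, star (if x = q then γ k w else 0) * (if x = q' then γ k w' else 0) = 0 :=
      fun k => Finset.sum_eq_zero fun x _ => by
        by_cases hx : x = q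
        · subst hx
          simp [hq]
        · simp [hx]
    simp only [this, Finset.sum_const_zero, hq, and_false, if_false]

theorem trace_rowOp_mul_rowOp {W E Q : Type} [Fintype W] [Fintype E] [Fintype Q] [DecidableEq E]
    [DecidableEq Q] (γ δ : E → ℂ) (γ' δ' : W → ℂ) :
    Matrix.trace ((rowOp (Q := Q) γ * rowOp (Q := E × Q) γ') *
      (rowOp (Q := Q) δ * rowOp (Q := E × Q) δ')ᵀ) =
      Fintype.card Q * (∑ e, γ e * δ e) * ∑ w, γ' w * δ' w := by
  have h : ∀ (γ : E → ℂ) (γ' : W → ℂ) (q : Q) (i : W × (E × Q)),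
      (rowOp (Q := Q) γ * rowOp (Q := E × Q) γ') q i =
        if q = i.2.2 then γ i.2.1 * γ' i.1 else 0 := by
    intro γ γ' q i
    rw [Matrix.mul_apply, Finset.sum_eq_single i.2]
    · simp [rowOp]
    · intro b _ hb
      simp [rowOp, hb]
    · simp
  have htr : ∀ A B : Matrix Q (W × (E × Q)) ℂ,
      Matrix.trace (A * Bᵀ) = ∑ q, ∑ i, A q i * B q i := fun A B => by
    simp [Matrix.trace, Matrix.mul_apply]
  simp only [htr, h, Fintype.sum_prod_type]
  have : ∀ (q : Q) (w : W) (e : E), ∑ q', (if q = q' then γ e * γ' w else 0) *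
      (if q = q' then δ e * δ' w else 0) = (γ e * δ e) * (γ' w * δ' w) := by
    intro q w e
    rw [Finset.sum_eq_single q]
    · simp only [if_true]
      ring
    · intro b _ hb
      simp [hb.symm]
    · simp
  simp only [this, Finset.sum_const, Finset.card_univ, nsmul_eq_mul]
  rw [mul_assoc, Finset.sum_mul_sum, Finset.sum_comm]

/-- The coisometry `∑ i, |i⟩⟨e i|`. -/
def embOp {I J : Type} [DecidableEq J] (e : I ↪ J) : Matrix I J ℂ :=
  Matrix.of fun i j => if e i = j then 1 else 0

theorem embOp_mul_transpose {I J : Type} [DecidableEq I] [Fintype J] [DecidableEq J] (e : I ↪ J) :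
    embOp e * (embOp e)ᵀ = 1 := by
  ext i i'
  simp [embOp, Matrix.mul_apply, Matrix.one_apply, eq_comm]

theorem conjTranspose_embOp_mul_diagonal {I J : Type} [Fintype I] [DecidableEq I]
    [DecidableEq J] (e : I ↪ J) (d : I → ℂ) :
    (embOp e)ᴴ * Matrix.diagonal d * embOp e =
      Matrix.diagonal fun j => ∑ i, if e i = j then d i else 0 := by
  ext j j'
  rw [Matrix.mul_apply]
  simp only [Matrix.mul_diagonal, Matrix.conjTranspose_apply, embOp, Matrix.of_apply,
    Matrix.diagonal_apply]
  by_cases h : j = j'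
  · subst h
    simp only [if_true]
    refine Finset.sum_congr rfl fun i _ => ?_
    by_cases hi : e i = j <;> simp [hi]
  · rw [if_neg h]
    refine Finset.sum_eq_zero fun i _ => ?_
    by_cases hi : e i = j
    · simp [hi, h]
    · simp [hi]

theorem isSubchannel_rowOp_mul_embOp {W Q J κ : Type} [Fintype W] [DecidableEq W] [Fintype Q]
    [DecidableEq Q] [Fintype J] [DecidableEq J] [Fintype κ] (e : W × Q ↪ J) (γ : κ → W → ℂ)
    (h : ∀ w w', ∑ k, star (γ k w) * γ k w' = if w = w' then 1 else 0) :
    IsSubchannel fun k => rowOp (Q := Q) (γ k) * embOp e := by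
  have h1 : ∑ k, (rowOp (Q := Q) (γ k) * embOp e)ᴴ * (rowOp (Q := Q) (γ k) * embOp e) =
      (embOp e)ᴴ * (∑ k, (rowOp (Q := Q) (γ k))ᴴ * rowOp (Q := Q) (γ k)) * embOp e := by
    simp only [Matrix.conjTranspose_mul, Matrix.mul_sum, Matrix.sum_mul, Matrix.mul_assoc]
  rw [IsSubchannel, h1, sum_rowOp_conjTranspose_mul_self _ (fun _ => 1) h,
    conjTranspose_embOp_mul_diagonal, ← sub_nonneg, ← Matrix.diagonal_one, Matrix.diagonal_sub,
    Matrix.nonneg_iff_posSemidef, Matrix.posSemidef_diagonal_iff]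
  intro j
  rw [sub_nonneg]
  by_cases hj : ∃ i, e i = j
  · obtain ⟨i, rfl⟩ := hj
    simp
  · push Not at hj
    simp [hj]

/-- Entanglement dilution: the shifts of an embedding, weighted by a subnormalized distribution,
form a measurement. -/
theorem isSubchannel_dilution {W Q κ : Type} {K : ℕ} [NeZero K] [Fintype W] [DecidableEq W]
    [Fintype Q] [DecidableEq Q] [Fintype κ] (e : W × Q ↪ Fin K) (γ : κ → W → ℂ) (d : W → ℝ)
    (hd : Fintype.card Q * ∑ w, d w ≤ 1)
    (h : ∀ w w', ∑ k, star (γ k w) * γ k w' = if w = w' then (d w : ℂ) else 0) :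
    IsSubchannel fun k : Fin K × κ =>
      rowOp (Q := Q) (γ k.2) * embOp (e.trans (Equiv.addRight k.1).toEmbedding) := by
  have h1 : ∀ j : Fin K, ∑ k, (rowOp (Q := Q) (γ k) *
      embOp (e.trans (Equiv.addRight j).toEmbedding))ᴴ *
      (rowOp (Q := Q) (γ k) * embOp (e.trans (Equiv.addRight j).toEmbedding)) =
      Matrix.diagonal fun l => ∑ i, if e i + j = l then (d i.1 : ℂ) else 0 := by
    intro j
    have := conjTranspose_embOp_mul_diagonal (e.trans (Equiv.addRight j).toEmbedding)
      (fun i => (d i.1 : ℂ))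
    simp only [Function.Embedding.trans_apply, Equiv.coe_toEmbedding, Equiv.coe_addRight] at this
    rw [← this, ← sum_rowOp_conjTranspose_mul_self _ _ h]
    simp only [Matrix.conjTranspose_mul, Matrix.mul_sum, Matrix.sum_mul, Matrix.mul_assoc]
  rw [IsSubchannel, Fintype.sum_prod_type]
  simp only [h1]
  -- For fixed i and l exactly one shift j has e i + j = l, so averaging over the shifts produces a
  -- scalar matrix.
  have h2 : ∑ j : Fin K, Matrix.diagonal (fun l => ∑ i, if e i + j = l then (d i.1 : ℂ) else 0) =
      Matrix.diagonal fun _ => ((Fintype.card Q * ∑ w, d w : ℝ) : ℂ) := by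
    ext l l'
    rw [Matrix.sum_apply]
    by_cases hl : l = l'
    · subst hl
      simp only [Matrix.diagonal_apply_eq]
      rw [Finset.sum_comm]
      have : ∀ i, ∑ j : Fin K, (if e i + j = l then (d i.1 : ℂ) else 0) = d i.1 := by
        intro i
        rw [Finset.sum_eq_single (l - e i)]
        · simp
        · intro b _ hb
          rw [if_neg]
          rintro rfl
          simp at hb
        · simp
      simp only [this, Fintype.sum_prod_type, Finset.sum_const, Finset.card_univ, nsmul_eq_mul,
        ← Finset.mul_sum]
      push_cast
      rfl
    · simp [hl]
  rw [h2, ← sub_nonneg, ← Matrix.diagonal_one, Matrix.diagonal_sub,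
    Matrix.nonneg_iff_posSemidef, Matrix.posSemidef_diagonal_iff]
  intro j
  rw [sub_nonneg]
  exact_mod_cast hd

/-! ### Characters of `(ℤ/2)ⁿ` -/

/-- The sign `(-1) ^ (a b)`. -/
def bitSign (a b : Fin 2) : ℂ := if a = 1 ∧ b = 1 then -1 else 1

/-- The sign `(-1) ^ (w · r)`. -/
def bitChar {n : ℕ} (w r : Fin n → Fin 2) : ℂ := ∏ i, bitSign (w i) (r i)

theorem bitSign_mul_self (a b : Fin 2) : bitSign a b * bitSign a b = 1 := by
  unfold bitSign
  split_ifs <;> norm_num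

theorem star_bitSign (a b : Fin 2) : star (bitSign a b) = bitSign a b := by
  unfold bitSign
  split_ifs <;> simp

theorem bitChar_mul_self {n : ℕ} (w r : Fin n → Fin 2) : bitChar w r * bitChar w r = 1 := by
  simp [bitChar, ← Finset.prod_mul_distrib, bitSign_mul_self]

theorem star_bitChar {n : ℕ} (w r : Fin n → Fin 2) : star (bitChar w r) = bitChar w r := by
  simp only [bitChar, star_prod, star_bitSign]

theorem bitChar_comm {n : ℕ} (w r : Fin n → Fin 2) : bitChar w r = bitChar r w := by
  simp only [bitChar, bitSign, and_comm]

theorem sum_prod_eq_ite {n : ℕ} {β α : Type} [Fintype α] [DecidableEq β] (F : β → β → α → ℂ)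
    (c : ℂ) (h : ∀ b b', ∑ a, F b b' a = if b = b' then c else 0) (w w' : Fin n → β) :
    ∑ r : Fin n → α, ∏ i, F (w i) (w' i) (r i) = if w = w' then c ^ n else 0 := by
  classical
  rw [← Fintype.piFinset_univ, ← Finset.prod_univ_sum (fun _ => Finset.univ)
    (fun i a => F (w i) (w' i) a)]
  simp only [h]
  split_ifs with hw
  · subst hw
    simp
  · obtain ⟨i, hi⟩ := Function.ne_iff.1 hw
    exact Finset.prod_eq_zero (Finset.mem_univ i) (if_neg hi)

theorem sum_bitChar_mul {n : ℕ} (w w' : Fin n → Fin 2) :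
    ∑ r, bitChar w r * bitChar w' r = if w = w' then (2 : ℂ) ^ n else 0 := by
  simp only [bitChar, ← Finset.prod_mul_distrib]
  refine sum_prod_eq_ite (fun b b' a => bitSign b a * bitSign b' a) 2 (fun b b' => ?_) w w'
  fin_cases b <;> fin_cases b' <;> norm_num [bitSign, Fin.sum_univ_two]

/-! ### Overlap of controlled operators with the target -/

/-- The references force the data bits of both vectors to agree, and ⟨Φ_L|(F ⊗ G)|Φ_K⟩ = Tr(F
Gᵀ)/√(KL). -/
theorem overlap_controlled {θ : ℝ} {n K L : ℕ}
    (f : (Fin n → Fin 2) → Matrix (Fin L) (Fin K) ℂ)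
    (h : (Fin n → Fin 2) → Matrix (Fin L) (Fin K) ℂ) :
    star (targetVec (gate θ) n L) ⬝ᵥ
        localAct (controlled f ⊗ₖ controlled h) (inputVec 2 n K) =
      (4 : ℂ)⁻¹ ^ n * (((Real.sqrt K)⁻¹ * (Real.sqrt L)⁻¹ : ℝ) : ℂ) *
        ∑ x, ∑ y, star (∏ i, gatePhase θ (x i) (y i)) * Matrix.trace (f x * (h y)ᵀ) := by
  set s : ℂ := (((Real.sqrt (2 : ℕ))⁻¹ : ℝ) : ℂ) with hs
  have hs2 : s * s = 2⁻¹ := by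
    rw [hs, ← Complex.ofReal_mul, ← mul_inv, Real.mul_self_sqrt (by positivity)]
    push_cast
    rfl
  have hstar : star s = s := by simp [hs]
  have hin : ∀ (x y r r' : Fin n → Fin 2) (l l' : Fin L),
      localAct (controlled f ⊗ₖ controlled h) (inputVec 2 n K) (((x, l), (y, l')), (r, r')) =
        if x = r ∧ y = r' then
          (((Real.sqrt K)⁻¹ : ℝ) : ℂ) * s ^ n * s ^ n * (f x * (h y)ᵀ) l l' else 0 := by
    intro x y r r' l l'
    rw [localAct_kronecker_inputVec]
    simp only [controlled_apply, maxEnt_prod, ite_mul, zero_mul, mul_ite, mul_zero, ← hs]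
    by_cases hx : x = r <;> by_cases hy : y = r' <;> simp [hx, hy]
    rw [Matrix.mul_apply, Finset.mul_sum]
    refine Finset.sum_congr rfl fun κ _ => ?_
    rw [Matrix.transpose_apply]
    ring
  have htar : ∀ (x y r r' : Fin n → Fin 2) (l l' : Fin L),
      targetVec (gate θ) n L (((x, l), (y, l')), (r, r')) =
        if l = l' then if x = r ∧ y = r' then (∏ i, gatePhase θ (x i) (y i)) * (s ^ n * s ^ n) *
          (((Real.sqrt L)⁻¹ : ℝ) : ℂ) else 0 else 0 := by
    intro x y r r' l l'
    rw [targetVec_gate, inputVec]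
    simp only [maxEnt_prod, ← hs]
    simp only [maxEnt]
    by_cases hx : x = r <;> by_cases hy : y = r' <;> by_cases hl : l = l' <;> simp [hx, hy, hl]
    ring
  have h4 : s ^ n * s ^ n * (s ^ n * s ^ n) = (4 : ℂ)⁻¹ ^ n := by
    rw [← mul_pow, hs2, ← mul_pow]
    norm_num
  calc _ = ∑ x : Fin n → Fin 2, ∑ l : Fin L, ∑ y : Fin n → Fin 2, ∑ l' : Fin L,
        ∑ r : Fin n → Fin 2, ∑ r' : Fin n → Fin 2,
          star (targetVec (gate θ) n L (((x, l), (y, l')), (r, r'))) *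
            localAct (controlled f ⊗ₖ controlled h) (inputVec 2 n K)
              (((x, l), (y, l')), (r, r')) := by
        simp only [dotProduct, Fintype.sum_prod_type, Pi.star_apply]
    _ = ∑ x : Fin n → Fin 2, ∑ l : Fin L, ∑ y : Fin n → Fin 2,
          (4 : ℂ)⁻¹ ^ n * (((Real.sqrt K)⁻¹ * (Real.sqrt L)⁻¹ : ℝ) : ℂ) *
            (star (∏ i, gatePhase θ (x i) (y i)) * (f x * (h y)ᵀ) l l) := by
        refine Finset.sum_congr rfl fun x _ => Finset.sum_congr rfl fun l _ =>
          Finset.sum_congr rfl fun y _ => ?_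
        rw [Finset.sum_eq_single l, Finset.sum_eq_single x, Finset.sum_eq_single y]
        · rw [hin, htar]
          simp only [if_true, and_self, star_mul', star_pow, hstar, RCLike.star_def,
            Complex.conj_ofReal]
          rw [← h4]
          push_cast
          ring
        · intro b _ hb
          simp [htar, hb.symm]
        · simp
        · intro b _ hb
          simp [htar, hb.symm]
        · simp
        · intro b _ hb
          simp [htar, hb.symm]
        · simp
    _ = _ := by
        simp only [← Finset.mul_sum]
        congr 1
        refine Finset.sum_congr rfl fun x _ => ?_
        rw [Finset.sum_comm]
        refine Finset.sum_congr rfl fun y _ => ?_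
        rw [← Finset.mul_sum]
        rfl

/-! ### The protocol -/

theorem isSubchannel_rowOp {W Q κ : Type} [Fintype W] [DecidableEq W] [Fintype Q]
    [DecidableEq Q] [Fintype κ] (γ : κ → W → ℂ)
    (h : ∀ w w', ∑ k, star (γ k w) * γ k w' = if w = w' then 1 else 0) :
    IsSubchannel fun k => rowOp (Q := Q) (γ k) := by
  rw [IsSubchannel, sum_rowOp_conjTranspose_mul_self _ (fun _ => 1) h, Matrix.diagonal_one]

theorem trace_branch {W E Q J : Type} [Fintype W] [DecidableEq W] [Fintype E] [Fintype Q]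
    [DecidableEq E] [DecidableEq Q] [Fintype J] [DecidableEq J] (e : W × (E × Q) ↪ J) (z : ℂ)
    (γ δ : E → ℂ) (γ' δ' : W → ℂ) :
    Matrix.trace (((z • (1 : Matrix Q Q ℂ)) * rowOp (Q := Q) γ *
      (rowOp (Q := E × Q) γ' * embOp e)) *
      (rowOp (Q := Q) δ * (rowOp (Q := E × Q) δ' * embOp e))ᵀ) =
      z * (Fintype.card Q * (∑ e, γ e * δ e) * ∑ w, γ' w * δ' w) := by
  rw [← trace_rowOp_mul_rowOp, ← smul_eq_mul, ← Matrix.trace_smul, Matrix.smul_mul, Matrix.one_mul,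
    ← Matrix.mul_assoc, ← Matrix.mul_assoc, Matrix.transpose_mul _ (embOp e), Matrix.mul_assoc,
    ← Matrix.mul_assoc (embOp e), embOp_mul_transpose, Matrix.one_mul, Matrix.smul_mul,
    Matrix.smul_mul]

theorem sum_sum_prod_eq_prod {n : ℕ} {α β : Type} [Fintype α] [Fintype β]
    (F : Fin n → α → β → ℂ) :
    ∑ x : Fin n → α, ∑ y : Fin n → β, ∏ i, F i (x i) (y i) = ∏ i, ∑ a, ∑ b, F i a b := by
  classical
  rw [Finset.prod_univ_sum, Fintype.piFinset_univ]
  refine Finset.sum_congr rfl fun x _ => ?_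
  rw [Finset.prod_univ_sum, Fintype.piFinset_univ]

/-- At most k positions need repair, so only those k control bits are handed over: g extracts them
from x and f locates them. With too many failures both are arbitrary. -/
theorem exists_compression {n k : ℕ} (hn : 0 < n) (hk : 0 < k) (s : Fin n → Fin 2) :
    ∃ (g : (Fin n → Fin 2) → (Fin k → Fin 2)) (f : Fin n → Fin k),
      (Finset.univ.filter fun i => s i = 1).card ≤ k → ∀ x i, s i = 1 → g x (f i) = x i := by
  classical
  have : Nonempty (Fin n) := ⟨⟨0, hn⟩⟩
  set A := Finset.univ.filter fun i => s i = 1 with hA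
  by_cases h : A.card ≤ k
  · let f : Fin n → Fin k := fun i =>
      if hi : i ∈ A then Fin.castLE h (A.equivFin ⟨i, hi⟩) else ⟨0, hk⟩
    have hf : Set.InjOn f A := by
      intro i hi j hj hij
      have hi' : i ∈ A := hi
      have hj' : j ∈ A := hj
      simpa [f, hi', hj'] using hij
    refine ⟨fun x a => x (Function.invFunOn f A a), f, fun _ x i hi => ?_⟩
    have hi' : i ∈ (A : Set (Fin n)) := by simp [hA, hi]
    exact congrArg x (hf.leftInvOn_invFunOn hi')
  · exact ⟨fun _ _ => 0, fun _ => ⟨0, hk⟩, fun h' => absurd h' h⟩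

/-- The single-copy data of the protocol: with the resource `∑ w, √(dist w) |w⟩|w⟩`, Bob's
measurement in the basis `coef` has the outcome `s`, whereupon the phases `corr s` are applied. The
outcome `0` needs a local correction only. -/
structure SiteProtocol (θ : ℝ) where
  coef : Fin 2 → Fin 2 → ℂ
  corr : Fin 2 → Fin 2 → Fin 2 → ℂ
  dist : Fin 2 → ℝ
  amp : Fin 2 → Fin 2 → ℝ
  coef_orth : ∀ w w', ∑ s, star (coef s w) * coef s w' = if w = w' then 1 else 0
  norm_corr : ∀ s x y, ‖corr s x y‖ = 1
  corr_zero : ∀ x y, corr 0 x y = corr 0 0 y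
  dist_nonneg : ∀ w, 0 ≤ dist w
  sum_dist : ∑ w, dist w = 1
  overlap : ∀ s w, (4 : ℂ)⁻¹ * ∑ x, ∑ y, star (gatePhase θ x y) * corr s x y *
    (Real.sqrt (dist w) : ℂ) * coef s w * bitSign w x * bitSign w y = amp s w

namespace SiteProtocol

variable {θ : ℝ} (D : SiteProtocol θ)

/-- The correction after the outcomes `s`, as a function of the compressed control bits `e`. -/
noncomputable def phase {n k : ℕ} (f : Fin n → Fin k) (s : Fin n → Fin 2) (e : Fin k → Fin 2)
    (y : Fin n → Fin 2) : ℂ :=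
  ∏ i, D.corr (s i) (if s i = 1 then e (f i) else 0) (y i)

theorem star_phase_mul_self {n k : ℕ} (f : Fin n → Fin k) (s : Fin n → Fin 2)
    (e : Fin k → Fin 2) (y : Fin n → Fin 2) :
    star (D.phase f s e y) * D.phase f s e y = 1 := by
  rw [RCLike.star_def, Complex.conj_mul', phase, norm_prod]
  simp [D.norm_corr]

theorem phase_eq {n k : ℕ} {f : Fin n → Fin k} {s : Fin n → Fin 2} {e : Fin k → Fin 2}
    {x : Fin n → Fin 2} (h : ∀ i, s i = 1 → e (f i) = x i) (y : Fin n → Fin 2) :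
    D.phase f s e y = ∏ i, D.corr (s i) (x i) (y i) := by
  refine Finset.prod_congr rfl fun i _ => ?_
  by_cases hs : s i = 1
  · rw [if_pos hs, h i hs]
  · have h0 : s i = 0 := by omega
    rw [if_neg hs, h0, ← D.corr_zero]

/-- Φ_K must contain the truncated resource, k ebits for repairs and the output Φ_L, whence the
bound on `T.card * 2 ^ k * L`. The register Fin L is carried along untouched. -/
theorem exists_isLOCC {n k K L : ℕ} (hn : 0 < n) (hk : 0 < k) (hK : 0 < K) (hL : 0 < L)
    (T S : Finset (Fin n → Fin 2))
    (hS : ∀ s ∈ S, (Finset.univ.filter fun i => s i = 1).card ≤ k)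
    (hcard : T.card * 2 ^ k * L ≤ K) :
    ∃ M, IsLOCC (Lab 2 n L) (Lab 2 n L) 4 Party.alice (Lab 2 n K) (Lab 2 n K) M ∧
      ∑ s ∈ S, (∑ w ∈ T, ∏ i, D.amp (s i) (w i)) ^ 2 ≤
        fidelity (withReference M (pureState (inputVec 2 n K)))
          (pureState (targetVec (gate θ) n L)) := by
  classical
  have : NeZero K := ⟨hK.ne'⟩
  have : Nonempty (Fin L) := ⟨⟨0, hL⟩⟩
  obtain ⟨ι⟩ : Nonempty ({w // w ∈ T} × ((Fin k → Fin 2) × Fin L) ↪ Fin K) := by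
    refine Function.Embedding.nonempty_of_card_le ?_
    simpa [mul_assoc] using hcard
  choose g f hgf using exists_compression (n := n) hn hk
  -- c² is 1/(2^k L 2^n): 2^k L is the size of the register carried through the dilution, 2^n
  -- normalizes Alice's Fourier measurement.
  let c : ℝ := (Real.sqrt (2 ^ k))⁻¹ * (Real.sqrt L)⁻¹ * (Real.sqrt (2 ^ n))⁻¹
  let sh : Fin K → {w // w ∈ T} × ((Fin k → Fin 2) × Fin L) ↪ Fin K := fun j =>
    ι.trans (Equiv.addRight j).toEmbedding
  -- Alice's first message: dilution weight, sign controlled by x, Fourier outcome r. The whole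
  -- weight √dist sits on her side; Bob only restricts to the same shifted embedding.
  let α₁ : (Fin n → Fin 2) → (Fin n → Fin 2) → {w // w ∈ T} → ℂ := fun x r w =>
    ((Real.sqrt (∏ i, D.dist (w.1 i)) * c : ℝ) : ℂ) * bitChar w.1 x * bitChar w.1 r
  -- Bob's first measurement: sign controlled by y, cancellation of r, tilted basis.
  let β₁ : (Fin n → Fin 2) → (Fin n → Fin 2) → (Fin n → Fin 2) → {w // w ∈ T} → ℂ :=
    fun y r s w => (∏ i, D.coef (s i) (w.1 i)) * bitChar w.1 y * bitChar w.1 r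
  -- Announcing m, Alice collapses the repair ebits to e = g s x + m, which hands her control bits
  -- to Bob coherently.
  let α₂ : (Fin n → Fin 2) → (Fin n → Fin 2) → (Fin k → Fin 2) → (Fin k → Fin 2) → ℂ :=
    fun x s m e => if e = g s x + m then 1 else 0
  -- Bob recovers the control bits as e - m, applies the phase and erases e by a Fourier
  -- measurement. Its outcome t leaves the sign `bitChar t (g s x + m)`, which Alice removes at the
  -- end.
  let β₂ : (Fin n → Fin 2) → (Fin n → Fin 2) → (Fin k → Fin 2) → (Fin k → Fin 2) →
      (Fin k → Fin 2) → ℂ :=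
    fun y s m t e => (((Real.sqrt (2 ^ k))⁻¹ : ℝ) : ℂ) * bitChar t e * D.phase (f s) s (e - m) y
  have hc : c ^ 2 = (2 ^ k)⁻¹ * (L : ℝ)⁻¹ * (2 ^ n)⁻¹ := by
    simp only [c, mul_pow, inv_pow]
    rw [Real.sq_sqrt (by positivity), Real.sq_sqrt (by positivity), Real.sq_sqrt (by positivity)]
  have hL' : (L : ℝ) ≠ 0 := by positivity
  have hP0 : ∀ w : Fin n → Fin 2, 0 ≤ ∏ i, D.dist (w i) := fun w =>
    Finset.prod_nonneg fun i _ => D.dist_nonneg _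
  have hα₁ : ∀ x, IsSubchannel fun p : Fin K × (Fin n → Fin 2) =>
      rowOp (Q := (Fin k → Fin 2) × Fin L) (α₁ x p.2) * embOp (sh p.1) := by
    intro x
    refine isSubchannel_dilution ι (fun r => α₁ x r)
      (fun w => (Real.sqrt (∏ i, D.dist (w.1 i)) * c) ^ 2 * 2 ^ n) ?_ fun w w' => ?_
    · have h1 : ∀ w : {w // w ∈ T}, (Real.sqrt (∏ i, D.dist (w.1 i)) * c) ^ 2 * 2 ^ n =
          (2 ^ k)⁻¹ * (L : ℝ)⁻¹ * ∏ i, D.dist (w.1 i) := by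
        intro w
        rw [mul_pow, Real.sq_sqrt (hP0 _), hc]
        field_simp
      have h2 : ∑ w : {w // w ∈ T}, ∏ i, D.dist (w.1 i) ≤ 1 := by
        rw [Finset.sum_coe_sort T fun w => ∏ i, D.dist (w i)]
        refine (Finset.sum_le_univ_sum_of_nonneg hP0).trans_eq ?_
        rw [← Fintype.sum_pow, D.sum_dist, one_pow]
      simp only [h1, ← Finset.mul_sum, Fintype.card_prod, Fintype.card_fun, Fintype.card_fin]
      refine le_of_eq_of_le ?_ h2
      push_cast
      field_simp
    · have h1 : ∀ r, star (α₁ x r w) * α₁ x r w' =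
          ((Real.sqrt (∏ i, D.dist (w.1 i)) * c : ℝ) : ℂ) *
            ((Real.sqrt (∏ i, D.dist (w'.1 i)) * c : ℝ) : ℂ) *
            (bitChar w.1 x * bitChar w'.1 x) * (bitChar w.1 r * bitChar w'.1 r) := by
        intro r
        simp only [α₁, star_mul', star_bitChar, RCLike.star_def, Complex.conj_ofReal]
        ring
      simp only [h1, ← Finset.mul_sum, sum_bitChar_mul]
      by_cases hw : w = w'
      · subst hw
        rw [if_pos rfl, if_pos rfl, bitChar_mul_self]
        push_cast
        ring
      · rw [if_neg hw, if_neg (fun h => hw (Subtype.ext h)), mul_zero]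
  have hβ₁ : ∀ y j r, IsSubchannel fun s : Fin n → Fin 2 =>
      rowOp (Q := (Fin k → Fin 2) × Fin L) (β₁ y r s) * embOp (sh j) := by
    intro y j r
    refine isSubchannel_rowOp_mul_embOp _ _ fun w w' => ?_
    have h1 : ∀ s, star (β₁ y r s w) * β₁ y r s w' =
        (bitChar w.1 y * bitChar w'.1 y * (bitChar w.1 r * bitChar w'.1 r)) *
          ∏ i, star (D.coef (s i) (w.1 i)) * D.coef (s i) (w'.1 i) := by
      intro s
      simp only [β₁, star_mul', star_bitChar, star_prod, Finset.prod_mul_distrib]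
      ring
    simp only [h1, ← Finset.mul_sum]
    rw [sum_prod_eq_ite (fun b b' a => star (D.coef a b) * D.coef a b') 1 D.coef_orth]
    by_cases hw : w = w'
    · subst hw
      simp [bitChar_mul_self]
    · rw [if_neg hw, if_neg (fun h => hw (Subtype.ext h)), mul_zero]
  have hα₂ : ∀ x s, IsSubchannel fun m => rowOp (Q := Fin L) (α₂ x s m) := by
    intro x s
    refine isSubchannel_rowOp _ fun e e' => ?_
    rw [Finset.sum_eq_single (e - g s x)]
    · simp [α₂, eq_comm]
    · intro m _ hm
      have : e ≠ g s x + m := fun h => hm (by rw [h, add_sub_cancel_left])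
      simp [α₂, this]
    · simp
  have hβ₂ : ∀ y s m, IsSubchannel fun t => rowOp (Q := Fin L) (β₂ y s m t) := by
    intro y s m
    refine isSubchannel_rowOp _ fun e e' => ?_
    have h1 : ∀ t, star (β₂ y s m t e) * β₂ y s m t e' =
        (((Real.sqrt (2 ^ k))⁻¹ * (Real.sqrt (2 ^ k))⁻¹ : ℝ) : ℂ) *
          (star (D.phase (f s) s (e - m) y) * D.phase (f s) s (e' - m) y) *
            (bitChar e t * bitChar e' t) := by
      intro t
      simp only [β₂, star_mul', star_bitChar, RCLike.star_def, Complex.conj_ofReal,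
        bitChar_comm t]
      push_cast
      ring
    simp only [h1, ← Finset.mul_sum, sum_bitChar_mul]
    by_cases he : e = e'
    · subst he
      rw [if_pos rfl, if_pos rfl, star_phase_mul_self, ← mul_inv,
        Real.mul_self_sqrt (by positivity)]
      push_cast
      field_simp
    · rw [if_neg he, if_neg he, mul_zero]
  obtain ⟨M, hM, hB⟩ := exists_isLOCC_four (a := Lab 2 n K) (b := Lab 2 n K)
    (a' := Lab 2 n L) (b' := Lab 2 n L)
    (A₁ := fun p : Fin K × (Fin n → Fin 2) =>
      controlled fun x => rowOp (Q := (Fin k → Fin 2) × Fin L) (α₁ x p.2) * embOp (sh p.1))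
    (B₁ := fun p s =>
      controlled fun y => rowOp (Q := (Fin k → Fin 2) × Fin L) (β₁ y p.2 s) * embOp (sh p.1))
    (A₂ := fun _ s m => controlled fun x => rowOp (Q := Fin L) (α₂ x s m))
    (B₂ := fun _ s m t => controlled fun y => rowOp (Q := Fin L) (β₂ y s m t))
    (A₃ := fun _ s m t => controlled fun x => bitChar t (g s x + m) • (1 : Matrix (Fin L) (Fin L) ℂ))
    (isSubchannel_controlled hα₁) (fun p => isSubchannel_controlled fun y => hβ₁ y p.1 p.2)
    (fun _ s => isSubchannel_controlled fun x => hα₂ x s)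
    (fun _ s m => isSubchannel_controlled fun y => hβ₂ y s m)
    (fun _ s m t => isSubchannel_controlled fun x => by
      simp [IsSubchannel, Matrix.conjTranspose_smul, smul_smul, bitChar_mul_self, star_bitChar])
  refine ⟨M, hM, le_trans ?_ (hB.le_fidelity _ _)⟩
  simp only [controlled_mul, overlap_controlled, trace_branch, Fintype.card_fin]
  -- The value is independent of r, m and t: every sign they introduce occurs twice and cancels.
  have key : ∀ (r s : Fin n → Fin 2) (m t : Fin k → Fin 2), s ∈ S →
      (4 : ℂ)⁻¹ ^ n * (((Real.sqrt K)⁻¹ * (Real.sqrt L)⁻¹ : ℝ) : ℂ) *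
        ∑ x, ∑ y, star (∏ i, gatePhase θ (x i) (y i)) * (bitChar t (g s x + m) *
          (L * (∑ e, α₂ x s m e * β₂ y s m t e) * ∑ w, α₁ x r w * β₁ y r s w)) =
      (((Real.sqrt K)⁻¹ * (2 ^ k)⁻¹ * (Real.sqrt (2 ^ n))⁻¹ *
        ∑ w ∈ T, ∏ i, D.amp (s i) (w i) : ℝ) : ℂ) := by
    intro r s m t hs
    have h1 : ∀ x y, ∑ e, α₂ x s m e * β₂ y s m t e =
        (((Real.sqrt (2 ^ k))⁻¹ : ℝ) : ℂ) * bitChar t (g s x + m) *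
          ∏ i, D.corr (s i) (x i) (y i) := by
      intro x y
      simp only [α₂, β₂, ite_mul, one_mul, zero_mul, Finset.sum_ite_eq', Finset.mem_univ, if_true,
        add_sub_cancel_right]
      rw [D.phase_eq (hgf s (hS s hs) x)]
    have h2 : ∀ x y, ∑ w, α₁ x r w * β₁ y r s w = (c : ℂ) * ∑ w ∈ T,
        ∏ i, (Real.sqrt (D.dist (w i)) : ℂ) * D.coef (s i) (w i) * bitSign (w i) (x i) *
          bitSign (w i) (y i) := by
      intro x y
      rw [← Finset.sum_coe_sort T, Finset.mul_sum]
      refine Finset.sum_congr rfl fun w _ => ?_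
      simp only [α₁, β₁, Finset.prod_mul_distrib]
      rw [Real.sqrt_prod _ fun i _ => D.dist_nonneg _]
      have := bitChar_mul_self w.1 r
      push_cast
      simp only [bitChar] at this ⊢
      linear_combination (c : ℂ) * (∏ i, (Real.sqrt (D.dist (w.1 i)) : ℂ)) *
        (∏ i, D.coef (s i) (w.1 i)) * (∏ i, bitSign (w.1 i) (x i)) *
        (∏ i, bitSign (w.1 i) (y i)) * this
    have h3 : ∀ w : Fin n → Fin 2, (4 : ℂ)⁻¹ ^ n * ∑ x : Fin n → Fin 2, ∑ y : Fin n → Fin 2,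
        ∏ i, (star (gatePhase θ (x i) (y i)) * D.corr (s i) (x i) (y i) *
          (Real.sqrt (D.dist (w i)) : ℂ) * D.coef (s i) (w i) * bitSign (w i) (x i) *
          bitSign (w i) (y i)) = ((∏ i, D.amp (s i) (w i) : ℝ) : ℂ) := by
      intro w
      rw [sum_sum_prod_eq_prod fun i a b => star (gatePhase θ a b) * D.corr (s i) a b *
          (Real.sqrt (D.dist (w i)) : ℂ) * D.coef (s i) (w i) * bitSign (w i) a *
          bitSign (w i) b]
      have : (4 : ℂ)⁻¹ ^ n = ∏ _i : Fin n, (4 : ℂ)⁻¹ := by simp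
      rw [this, ← Finset.prod_mul_distrib]
      simp only [D.overlap]
      push_cast
      rfl
    have h4 : ∀ x y, star (∏ i, gatePhase θ (x i) (y i)) * (bitChar t (g s x + m) *
          (L * (∑ e, α₂ x s m e * β₂ y s m t e) * ∑ w, α₁ x r w * β₁ y r s w)) =
        (L * (((Real.sqrt (2 ^ k))⁻¹ : ℝ) : ℂ) * c) * ∑ w ∈ T,
        ∏ i, (star (gatePhase θ (x i) (y i)) * D.corr (s i) (x i) (y i) *
          (Real.sqrt (D.dist (w i)) : ℂ) * D.coef (s i) (w i) * bitSign (w i) (x i) *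
          bitSign (w i) (y i)) := by
      intro x y
      rw [h1, h2]
      have := bitChar_mul_self t (g s x + m)
      have h5 : ∑ w ∈ T, ∏ i, (star (gatePhase θ (x i) (y i)) * D.corr (s i) (x i) (y i) *
          (Real.sqrt (D.dist (w i)) : ℂ) * D.coef (s i) (w i) * bitSign (w i) (x i) *
          bitSign (w i) (y i)) = star (∏ i, gatePhase θ (x i) (y i)) *
          (∏ i, D.corr (s i) (x i) (y i)) * ∑ w ∈ T,
          ∏ i, (Real.sqrt (D.dist (w i)) : ℂ) * D.coef (s i) (w i) * bitSign (w i) (x i) *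
          bitSign (w i) (y i) := by
        rw [Finset.mul_sum, star_prod]
        refine Finset.sum_congr rfl fun w _ => ?_
        simp only [Finset.prod_mul_distrib]
        ring
      rw [h5]
      linear_combination (star (∏ i, gatePhase θ (x i) (y i)) * L *
        (((Real.sqrt (2 ^ k))⁻¹ : ℝ) : ℂ) * (∏ i, D.corr (s i) (x i) (y i)) * (c : ℂ) *
        ∑ w ∈ T, ∏ i, (Real.sqrt (D.dist (w i)) : ℂ) * D.coef (s i) (w i) *
          bitSign (w i) (x i) * bitSign (w i) (y i)) * this
    have h6 : ∑ x : Fin n → Fin 2, ∑ y : Fin n → Fin 2, ∑ w ∈ T,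
        ∏ i, (star (gatePhase θ (x i) (y i)) * D.corr (s i) (x i) (y i) *
          (Real.sqrt (D.dist (w i)) : ℂ) * D.coef (s i) (w i) * bitSign (w i) (x i) *
          bitSign (w i) (y i)) = ∑ w ∈ T, ∑ x : Fin n → Fin 2, ∑ y : Fin n → Fin 2,
        ∏ i, (star (gatePhase θ (x i) (y i)) * D.corr (s i) (x i) (y i) *
          (Real.sqrt (D.dist (w i)) : ℂ) * D.coef (s i) (w i) * bitSign (w i) (x i) *
          bitSign (w i) (y i)) := by
      rw [Finset.sum_comm]
      refine (Finset.sum_congr rfl fun x _ => Finset.sum_comm).trans ?_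
      rw [Finset.sum_comm]
      exact Finset.sum_congr rfl fun w _ => Finset.sum_comm
    have hconst : (Real.sqrt K)⁻¹ * (Real.sqrt L)⁻¹ * (L * (Real.sqrt (2 ^ k))⁻¹ * c) =
        (Real.sqrt K)⁻¹ * (2 ^ k)⁻¹ * (Real.sqrt (2 ^ n))⁻¹ := by
      have e1 : (Real.sqrt L)⁻¹ * (Real.sqrt L)⁻¹ * L = 1 := by
        rw [← mul_inv, Real.mul_self_sqrt (by positivity), inv_mul_cancel₀ hL']
      have e2 : (Real.sqrt (2 ^ k))⁻¹ * (Real.sqrt (2 ^ k))⁻¹ = (2 ^ k : ℝ)⁻¹ := by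
        rw [← mul_inv, Real.mul_self_sqrt (by positivity)]
      calc _ = (Real.sqrt K)⁻¹ * ((Real.sqrt L)⁻¹ * (Real.sqrt L)⁻¹ * L) *
            ((Real.sqrt (2 ^ k))⁻¹ * (Real.sqrt (2 ^ k))⁻¹) * (Real.sqrt (2 ^ n))⁻¹ := by
            simp only [c]
            ring
        _ = _ := by rw [e1, e2, mul_one]
    simp only [h4, ← Finset.mul_sum]
    rw [h6, ← hconst]
    push_cast
    have h7 : ∑ w ∈ T, ∏ i, (D.amp (s i) (w i) : ℂ) = (4 : ℂ)⁻¹ ^ n * ∑ w ∈ T,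
        ∑ x : Fin n → Fin 2, ∑ y : Fin n → Fin 2,
        ∏ i, (star (gatePhase θ (x i) (y i)) * D.corr (s i) (x i) (y i) *
          (Real.sqrt (D.dist (w i)) : ℂ) * D.coef (s i) (w i) * bitSign (w i) (x i) *
          bitSign (w i) (y i)) := by
      rw [Finset.mul_sum]
      refine Finset.sum_congr rfl fun w _ => ?_
      rw [h3]
      push_cast
      rfl
    rw [h7]
    ring
  have hterm : ∀ (r s : Fin n → Fin 2) (m t : Fin k → Fin 2),
      (if s ∈ S then (K : ℝ)⁻¹ * ((2 ^ k)⁻¹) ^ 2 * (2 ^ n)⁻¹ *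
        (∑ w ∈ T, ∏ i, D.amp (s i) (w i)) ^ 2 else 0) ≤
      ‖(4 : ℂ)⁻¹ ^ n * (((Real.sqrt K)⁻¹ * (Real.sqrt L)⁻¹ : ℝ) : ℂ) *
        ∑ x, ∑ y, star (∏ i, gatePhase θ (x i) (y i)) * (bitChar t (g s x + m) *
          (L * (∑ e, α₂ x s m e * β₂ y s m t e) * ∑ w, α₁ x r w * β₁ y r s w))‖ ^ 2 := by
    intro r s m t
    split_ifs with hs
    · rw [key r s m t hs, Complex.norm_real, Real.norm_eq_abs, sq_abs, mul_pow, mul_pow, mul_pow,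
        inv_pow (Real.sqrt _), inv_pow (Real.sqrt _), Real.sq_sqrt (by positivity),
        Real.sq_sqrt (by positivity)]
    · positivity
  have hK' : (K : ℝ) ≠ 0 := by positivity
  -- For each s there are K · 2^n · 2^k · 2^k branches (j, r, m, t), which exactly cancels the
  -- weight of each one.
  calc ∑ s ∈ S, (∑ w ∈ T, ∏ i, D.amp (s i) (w i)) ^ 2
      = ∑ _j : Fin K, ∑ _r : Fin n → Fin 2, ∑ s : Fin n → Fin 2, ∑ _m : Fin k → Fin 2,
          ∑ _t : Fin k → Fin 2, ∑ _u : Unit,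
          (if s ∈ S then (K : ℝ)⁻¹ * ((2 ^ k)⁻¹) ^ 2 * (2 ^ n)⁻¹ *
            (∑ w ∈ T, ∏ i, D.amp (s i) (w i)) ^ 2 else 0) := by
        simp only [Finset.sum_const, Finset.card_univ, Fintype.card_fun, Fintype.card_fin,
          nsmul_eq_mul, ← Finset.mul_sum, Finset.sum_ite_mem, Finset.univ_inter,
          Fintype.card_unit]
        push_cast
        field_simp
    _ ≤ _ := by
        simp only [Fintype.sum_prod_type]
        exact Finset.sum_le_sum fun j _ => Finset.sum_le_sum fun r _ =>
          Finset.sum_le_sum fun s _ => Finset.sum_le_sum fun m _ => Finset.sum_le_sum fun t _ =>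
          Finset.sum_le_sum fun u _ => hterm r s m t

end SiteProtocol

/-! ### The single-copy protocol -/

/-- The product of signs is ±1, so the modulus does not depend on x and y. This is why every outcome
can be corrected by pure phases. -/
theorem norm_ofReal_add_ofReal_mul_I_mul_bitSign {u v r : ℝ} (hr : 0 ≤ r)
    (h : u ^ 2 + v ^ 2 = r ^ 2) (x y : Fin 2) :
    ‖(u : ℂ) + v * Complex.I * (bitSign 1 x * bitSign 1 y)‖ = r := by
  have h1 : ∃ z : ℝ, bitSign 1 x * bitSign 1 y = z ∧ z ^ 2 = 1 := by
    unfold bitSign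
    split_ifs
    exacts [⟨1, by simp⟩, ⟨-1, by simp⟩, ⟨-1, by simp⟩, ⟨1, by simp⟩]
  obtain ⟨z, hz, hz2⟩ := h1
  rw [hz, show (u : ℂ) + v * Complex.I * z = (u : ℂ) + ((v * z : ℝ) : ℂ) * Complex.I by
    push_cast
    ring, Complex.norm_add_mul_I, mul_pow, hz2, mul_one, h, Real.sqrt_sq hr]

theorem gatePhase_one (θ : ℝ) (y : Fin 2) :
    gatePhase θ 1 y =
      ((Real.cos (θ / 2) : ℂ) + Real.sin (θ / 2) * Complex.I * bitSign 1 y) ^ 2 := by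
  have h2 : ((θ : ℝ) : ℂ) = 2 * ((θ / 2 : ℝ) : ℂ) := by push_cast; ring
  have h1 : gatePhase θ 1 y = Complex.exp (((θ / 2 : ℝ) : ℂ) * bitSign 1 y * Complex.I) ^ 2 := by
    rw [← Complex.exp_nat_mul]
    unfold gatePhase bitSign
    fin_cases y <;> simp <;> ring_nf
  rw [h1, Complex.exp_mul_I]
  unfold bitSign
  fin_cases y <;> simp

/-- The parameters `a`, `b` are the Schmidt coefficients of the resource, `J` is the joint
distribution of Bob's outcome and the Schmidt index. -/
theorem exists_siteProtocol {θ a b : ℝ} (ha : 0 < a) (hb : 0 < b) (hab : a ^ 2 + b ^ 2 = 1)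
    (hC : 0 < Real.cos (θ / 2)) (hS : 0 < Real.sin (θ / 2)) :
    ∃ (D : SiteProtocol θ) (J : Fin 2 → Fin 2 → ℝ),
      (∀ s w, 0 ≤ J s w) ∧ (∀ s, 0 < ∑ w, J s w) ∧
      (∀ s w, D.amp s w = J s w / Real.sqrt (∑ w, J s w)) ∧ (∀ w, ∑ s, J s w = D.dist w) ∧
      D.dist 0 = a ^ 2 ∧ D.dist 1 = b ^ 2 ∧
      ∑ w, J 0 w = a ^ 2 * b ^ 2 /
        (Real.cos (θ / 2) ^ 2 * b ^ 2 + Real.sin (θ / 2) ^ 2 * a ^ 2) := by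
  have hgp := gatePhase_one θ
  have hCS : Real.cos (θ / 2) ^ 2 + Real.sin (θ / 2) ^ 2 = 1 := Real.cos_sq_add_sin_sq _
  set C := Real.cos (θ / 2)
  set S := Real.sin (θ / 2)
  -- N normalizes Bob's basis; R/N is the modulus of the operator of the failing outcome.
  obtain ⟨N, hN, hN2⟩ : ∃ N : ℝ, 0 < N ∧ N ^ 2 = C ^ 2 * b ^ 2 + S ^ 2 * a ^ 2 :=
    ⟨Real.sqrt (C ^ 2 * b ^ 2 + S ^ 2 * a ^ 2), by positivity, Real.sq_sqrt (by positivity)⟩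
  obtain ⟨R, hR, hR2⟩ : ∃ R : ℝ, 0 < R ∧ R ^ 2 = a ^ 4 * S ^ 2 + b ^ 4 * C ^ 2 :=
    ⟨Real.sqrt (a ^ 4 * S ^ 2 + b ^ 4 * C ^ 2), by positivity, Real.sq_sqrt (by positivity)⟩
  have hNc : (N : ℂ) ≠ 0 := by exact_mod_cast hN.ne'
  have hRc : (R : ℂ) ≠ 0 := by exact_mod_cast hR.ne'
  have hN2c : (N : ℂ) ^ 2 = C ^ 2 * b ^ 2 + S ^ 2 * a ^ 2 := by exact_mod_cast hN2
  have hCSc : (C : ℂ) ^ 2 + (S : ℂ) ^ 2 = 1 := by exact_mod_cast hCS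
  have hgg : ∀ x y, star (gatePhase θ x y) * gatePhase θ x y = 1 := by
    intro x y
    rw [RCLike.star_def, Complex.conj_mul', norm_gatePhase]
    simp
  -- The entries are dist w · ‖coef s w‖².
  let J : Fin 2 → Fin 2 → ℝ :=
    ![![a ^ 2 * b ^ 2 * C ^ 2 / N ^ 2, b ^ 2 * a ^ 2 * S ^ 2 / N ^ 2],
      ![a ^ 4 * S ^ 2 / N ^ 2, b ^ 4 * C ^ 2 / N ^ 2]]
  -- The first row is forced up to scale: a · coef 0 0 + b · coef 0 1 · z must be proportional to C
  -- - iSz. The second row completes the basis.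
  let coef : Fin 2 → Fin 2 → ℂ :=
    ![![b * C / N, -(a * S / N * Complex.I)], ![a * S / N, b * C / N * Complex.I]]
  -- The conjugates of the operators implemented on the two outcomes, scaled to modulus 1; the
  -- required correction is the gate times this phase.
  let dev : Fin 2 → Fin 2 → Fin 2 → ℂ :=
    ![fun x y => (C : ℂ) + S * Complex.I * (bitSign 1 x * bitSign 1 y),
      fun x y => (((a ^ 2 * S / R : ℝ) : ℂ) +
        ((-(b ^ 2 * C / R) : ℝ) : ℂ) * Complex.I * (bitSign 1 x * bitSign 1 y))]
  let amp : Fin 2 → Fin 2 → ℝ :=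
    ![![a * b * C ^ 2 / N, a * b * S ^ 2 / N],
      ![a ^ 4 * S ^ 2 / (N * R), b ^ 4 * C ^ 2 / (N * R)]]
  have hJ0 : ∑ w, J 0 w = (a * b / N) ^ 2 := by
    simp only [J, Fin.sum_univ_two, Matrix.cons_val_zero, Matrix.cons_val_one]
    field_simp
    linear_combination hCS
  have hJ1 : ∑ w, J 1 w = (R / N) ^ 2 := by
    simp only [J, Fin.sum_univ_two, Matrix.cons_val_zero, Matrix.cons_val_one]
    rw [div_pow, hR2]
    ring
  have hov : ∀ s w, (4 : ℂ)⁻¹ * ∑ x, ∑ y, dev s x y * (Real.sqrt (![a ^ 2, b ^ 2] w) : ℂ) *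
      coef s w * bitSign w x * bitSign w y = amp s w := by
    intro s w
    fin_cases s <;> fin_cases w <;>
      simp [Fin.sum_univ_two, dev, coef, amp, bitSign, Real.sqrt_sq ha.le,
        Real.sqrt_sq hb.le] <;> field_simp <;> ring_nf <;>
      simp only [Complex.I_sq] <;> ring
  have hsum : ∀ w, ∑ s, J s w = ![a ^ 2, b ^ 2] w := by
    intro w
    fin_cases w <;> simp [J, Fin.sum_univ_two] <;> field_simp <;> rw [hN2]
    · ring
    · ring
  let D : SiteProtocol θ :=
    { coef := coef
      corr := fun s x y => gatePhase θ x y * dev s x y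
      dist := ![a ^ 2, b ^ 2]
      amp := amp
      coef_orth := by
        intro w w'
        fin_cases w <;> fin_cases w' <;>
          simp [coef, Fin.sum_univ_two] <;> field_simp <;> ring_nf <;>
          simp only [Complex.I_sq, hN2c] <;> ring
      norm_corr := by
        intro s x y
        rw [norm_mul, norm_gatePhase, one_mul]
        fin_cases s
        · exact norm_ofReal_add_ofReal_mul_I_mul_bitSign zero_le_one (by rw [hCS, one_pow]) x y
        · refine norm_ofReal_add_ofReal_mul_I_mul_bitSign zero_le_one ?_ x y
          field_simp
          rw [hR2]
      corr_zero := by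
        intro x y
        fin_cases x
        · rfl
        · have h0 : gatePhase θ 0 y = 1 := by simp [gatePhase]
          -- With g = C + iS(-1)^y of modulus 1, the gate phase at x = 1 is g² and `dev` is the
          -- conjugate of g there, so both sides equal g.
          show gatePhase θ 1 y * dev 0 1 y = gatePhase θ 0 y * dev 0 0 y
          rw [hgp, h0]
          fin_cases y <;> simp [dev, bitSign]
          · linear_combination ((C : ℂ) + S * Complex.I) * hCSc -
              ((C : ℂ) + S * Complex.I) * S ^ 2 * Complex.I_sq
          · linear_combination ((C : ℂ) - S * Complex.I) * hCSc -
              ((C : ℂ) - S * Complex.I) * S ^ 2 * Complex.I_sq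
      dist_nonneg := by
        intro w
        fin_cases w <;> simp <;> positivity
      sum_dist := by simpa [Fin.sum_univ_two] using hab
      overlap := by
        intro s w
        simp only [← mul_assoc, hgg, one_mul]
        exact hov s w }
  refine ⟨D, J, ?_, ?_, ?_, ?_, rfl, rfl, ?_⟩
  · intro s w
    fin_cases s <;> fin_cases w <;> simp [J] <;> positivity
  · intro s
    fin_cases s
    · exact hJ0 ▸ by positivity
    · exact hJ1 ▸ by positivity
  · intro s w
    fin_cases s
    · show amp 0 w = J 0 w / Real.sqrt (∑ w, J 0 w)
      rw [hJ0, Real.sqrt_sq (by positivity)]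
      fin_cases w <;> simp [amp, J] <;> field_simp
    · show amp 1 w = J 1 w / Real.sqrt (∑ w, J 1 w)
      rw [hJ1, Real.sqrt_sq (by positivity)]
      fin_cases w <;> simp [amp, J] <;> field_simp
  · exact hsum
  · rw [hJ0, div_pow, hN2, mul_pow]

/-! ### The rate bound -/

theorem successProb_eq (α θ : ℝ) :
    successProb α θ = Real.cos (α / 2) ^ 2 * Real.sin (α / 2) ^ 2 /
      (Real.cos (θ / 2) ^ 2 * Real.sin (α / 2) ^ 2 +
        Real.sin (θ / 2) ^ 2 * Real.cos (α / 2) ^ 2) := by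
  have h1 : Real.sin α = 2 * Real.sin (α / 2) * Real.cos (α / 2) := by
    rw [← Real.sin_two_mul]
    ring_nf
  have h2 : ∀ β : ℝ, Real.cos β = 2 * Real.cos (β / 2) ^ 2 - 1 := fun β => by
    rw [← Real.cos_two_mul]
    ring_nf
  rw [successProb, h1, h2 θ, h2 α, Real.sin_sq (α / 2), Real.sin_sq (θ / 2)]
  rw [show 2 * (1 - (2 * Real.cos (θ / 2) ^ 2 - 1) * (2 * Real.cos (α / 2) ^ 2 - 1)) =
    4 * (Real.cos (θ / 2) ^ 2 * (1 - Real.cos (α / 2) ^ 2) +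
      (1 - Real.cos (θ / 2) ^ 2) * Real.cos (α / 2) ^ 2) by ring,
    show (2 * Real.sin (α / 2) * Real.cos (α / 2)) ^ 2 =
    4 * (Real.cos (α / 2) ^ 2 * Real.sin (α / 2) ^ 2) by ring, Real.sin_sq (α / 2),
    mul_div_mul_left _ _ (by norm_num : (4 : ℝ) ≠ 0)]

theorem binEnt_eq (x : ℝ) : binEnt x = Real.binEntropy x / Real.log 2 := by
  simp only [binEnt, Real.binEntropy, Real.logb, Real.log_inv]
  ring

theorem one_sub_cos_eq (x : ℝ) : 1 - Real.cos x = x ^ 2 / 2 * Real.sinc (x / 2) ^ 2 := by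
  by_cases hx : x = 0
  · simp [hx]
  · rw [Real.sinc_of_ne_zero (by simpa using hx)]
    have h1 := Real.cos_two_mul (x / 2)
    rw [mul_div_cancel₀ x two_ne_zero] at h1
    have h2 := Real.sin_sq (x / 2)
    field_simp
    linarith

/-- With t = √θ, both sin² t and 2(1 - cos t² cos t) are t² to leading order. Writing them with
`Real.sinc` divides out t² and leaves a function continuous at 0. -/
theorem tendsto_successProb_sqrt :
    Tendsto (fun θ => successProb (Real.sqrt θ) θ) (𝓝[>] 0) (𝓝 1) := by
  let g : ℝ → ℝ := fun t => Real.sinc t ^ 2 /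
    (Real.sinc (t / 2) ^ 2 + Real.cos t * t ^ 2 * Real.sinc (t ^ 2 / 2) ^ 2)
  have hs := Real.continuous_sinc
  have hg : ContinuousAt g 0 := by
    refine ContinuousAt.div (by fun_prop) (by fun_prop) ?_
    simp
  have hg0 : g 0 = 1 := by simp [g]
  have h1 : Tendsto (fun θ => g (Real.sqrt θ)) (𝓝[>] 0) (𝓝 1) := by
    have h2 : Tendsto Real.sqrt (𝓝[>] 0) (𝓝 0) := by
      simpa using (Real.continuous_sqrt.tendsto 0).mono_left nhdsWithin_le_nhds
    have := hg.tendsto.comp h2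
    rwa [hg0] at this
  refine h1.congr' ?_
  filter_upwards [self_mem_nhdsWithin] with θ hθ
  have hθ' : 0 < θ := hθ
  have ht : 0 < Real.sqrt θ := Real.sqrt_pos.2 hθ'
  obtain ⟨t, htd⟩ : ∃ t, t = Real.sqrt θ := ⟨_, rfl⟩
  have hθt : θ = t ^ 2 := by rw [htd, Real.sq_sqrt hθ'.le]
  rw [← htd, hθt]
  rw [← htd] at ht
  have h3 : Real.sin t ^ 2 = t ^ 2 * Real.sinc t ^ 2 := by
    rw [Real.sinc_of_ne_zero ht.ne']
    field_simp
  -- Splits 1 - cos t² cos t as (1 - cos t) + cos t (1 - cos t²).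
  have h4 : 2 * (1 - Real.cos (t ^ 2) * Real.cos t) = t ^ 2 *
      (Real.sinc (t / 2) ^ 2 + Real.cos t * t ^ 2 * Real.sinc (t ^ 2 / 2) ^ 2) := by
    linear_combination 2 * one_sub_cos_eq t + 2 * Real.cos t * one_sub_cos_eq (t ^ 2)
  rw [successProb, h3, h4, mul_div_mul_left _ _ (by positivity)]

theorem tendsto_rateBound : Tendsto rateBound (𝓝[>] 0) (𝓝 0) := by
  have h1 : Continuous fun θ => binEnt (Real.cos (Real.sqrt θ / 2) ^ 2) := by
    simp only [binEnt_eq]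
    exact (Real.binEntropy_continuous.comp (by fun_prop)).div_const _
  have h2 : Tendsto (fun θ => binEnt (Real.cos (Real.sqrt θ / 2) ^ 2)) (𝓝[>] 0) (𝓝 0) := by
    have := (h1.tendsto 0).mono_left (nhdsWithin_le_nhds (s := Set.Ioi 0))
    simpa [binEnt_eq] using this
  have := ((tendsto_const_nhds (x := (1 : ℝ))).sub tendsto_successProb_sqrt).add h2
  rw [sub_self, add_zero] at this
  exact this

/-! ### Achievable rates -/

/-- A threshold logarithmic in 1/ε suffices. The factor 3 is for one atypicality probability of
outcomes plus twice that of resource strings. -/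
theorem exists_threshold {ρ : ℝ} (h0 : 0 < ρ) (h1 : ρ < 1) (n₀ : ℕ) :
    ∃ N : ℝ → ℕ, (∀ ε : ℝ, 0 < ε → ∀ n, N ε ≤ n → n₀ ≤ n ∧ 3 * ρ ^ n ≤ ε) ∧
      Tendsto (fun ε : ℝ => ε * (N ε : ℝ) ^ 4) (𝓝[>] 0) (𝓝 0) := by
  have hlog : Real.log ρ < 0 := Real.log_neg h0 h1
  obtain ⟨b, hb, hbd⟩ : ∃ b, 0 < b ∧ b * Real.log ρ = -1 :=
    ⟨(-Real.log ρ)⁻¹, by simpa using hlog, by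
      rw [inv_neg, neg_mul, inv_mul_cancel₀ hlog.ne]⟩
  refine ⟨fun ε => n₀ + ⌈b * (Real.log 3 - Real.log ε)⌉₊, fun ε hε n hn => ?_, ?_⟩
  · replace hn : n₀ + ⌈b * (Real.log 3 - Real.log ε)⌉₊ ≤ n := hn
    refine ⟨(Nat.le_add_right _ _).trans hn, ?_⟩
    have h2 : b * (Real.log 3 - Real.log ε) ≤ n :=
      (Nat.le_ceil _).trans (by exact_mod_cast (Nat.le_add_left _ _).trans hn)
    have h3 : n * Real.log ρ ≤ Real.log ε - Real.log 3 := by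
      have := mul_le_mul_of_nonpos_right h2 hlog.le
      linear_combination this + (Real.log 3 - Real.log ε) * hbd
    rw [← Real.log_div hε.ne' (by norm_num), ← Real.log_pow,
      Real.log_le_log_iff (by positivity) (by positivity)] at h3
    linarith
  -- Distributing ε as (ε^(1/4))⁴ over the fourth power reduces the limit to ε^(1/4) log ε → 0.
  · have hlim : Tendsto (fun ε : ℝ => ((n₀ + b * Real.log 3 + 1) * ε ^ (4⁻¹ : ℝ) -
        b * (Real.log ε * ε ^ (4⁻¹ : ℝ))) ^ 4) (𝓝[>] 0) (𝓝 0) := by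
      have h2 : Tendsto (fun ε : ℝ => ε ^ (4⁻¹ : ℝ)) (𝓝[>] 0) (𝓝 0) := by
        have := (Real.continuousAt_rpow_const 0 (4⁻¹ : ℝ) (Or.inr (by norm_num))).tendsto
        rw [Real.zero_rpow (by norm_num)] at this
        exact this.mono_left nhdsWithin_le_nhds
      have h3 := tendsto_log_mul_rpow_nhdsGT_zero (r := (4⁻¹ : ℝ)) (by norm_num)
      simpa using ((h2.const_mul (n₀ + b * Real.log 3 + 1)).sub (h3.const_mul b)).pow 4
    refine tendsto_of_tendsto_of_tendsto_of_le_of_le' tendsto_const_nhds hlim ?_ ?_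
    · filter_upwards [self_mem_nhdsWithin] with ε hε
      have : 0 < ε := hε
      positivity
    · filter_upwards [Ioo_mem_nhdsGT (zero_lt_one : (0 : ℝ) < 1)] with ε hε
      have hε0 : 0 ≤ ε := hε.1.le
      have h4 : ε = (ε ^ (4⁻¹ : ℝ)) ^ 4 := by
        rw [← Real.rpow_natCast, ← Real.rpow_mul hε0]
        norm_num
      have h5 : 0 ≤ b * (Real.log 3 - Real.log ε) := by
        have := Real.log_neg hε.1 hε.2
        have := Real.log_pos (by norm_num : (1 : ℝ) < 3)
        exact mul_nonneg hb.le (by linarith)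
      have h6 : ((n₀ + ⌈b * (Real.log 3 - Real.log ε)⌉₊ : ℕ) : ℝ) ≤
          n₀ + b * Real.log 3 + 1 - b * Real.log ε := by
        have := (Nat.ceil_lt_add_one h5).le
        push_cast
        linarith
      calc ε * ((n₀ + ⌈b * (Real.log 3 - Real.log ε)⌉₊ : ℕ) : ℝ) ^ 4
          ≤ ε * (n₀ + b * Real.log 3 + 1 - b * Real.log ε) ^ 4 := by gcongr
        _ = (ε ^ (4⁻¹ : ℝ)) ^ 4 * (n₀ + b * Real.log 3 + 1 - b * Real.log ε) ^ 4 := by rw [← h4]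
        _ = _ := by ring

/-- The cost must equal nE exactly for all large n. Rates log₂(A/B) allow this, with K = Aⁿ and L =
Bⁿ. -/
theorem achievable_of_rateBound_lt {θ : ℝ} (h0 : 0 < θ) (h1 : θ ≤ Real.pi / 2) {A B : ℕ}
    (hA : 0 < A) (hB : 0 < B) (hE : rateBound θ < Real.logb 2 A - Real.logb 2 B) :
    Achievable (gate θ) 4 (Real.logb 2 A - Real.logb 2 B) := by
  set E : ℝ := Real.logb 2 A - Real.logb 2 B with hEdef
  have hpi := Real.pi_pos
  have hpi4 := Real.pi_le_four
  have ht0 : 0 < Real.sqrt θ := Real.sqrt_pos.2 h0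
  have htp : Real.sqrt θ < Real.pi := by
    rw [Real.sqrt_lt' hpi]
    nlinarith [Real.pi_gt_three]
  have ha : 0 < Real.cos (Real.sqrt θ / 2) :=
    Real.cos_pos_of_mem_Ioo ⟨by linarith, by linarith⟩
  have hb : 0 < Real.sin (Real.sqrt θ / 2) := Real.sin_pos_of_pos_of_lt_pi (by linarith) (by linarith)
  have hC : 0 < Real.cos (θ / 2) := Real.cos_pos_of_mem_Ioo ⟨by linarith, by linarith⟩
  have hS : 0 < Real.sin (θ / 2) := Real.sin_pos_of_pos_of_lt_pi (by linarith) (by linarith)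
  obtain ⟨D, J, hJ, hJpos, hamp, hJd, hd0, hd1, hJ0⟩ :=
    exists_siteProtocol ha hb (Real.cos_sq_add_sin_sq _) hC hS
  rw [← successProb_eq] at hJ0
  have hdpos : ∀ w, 0 < D.dist w := by
    intro w
    fin_cases w
    · exact hd0 ▸ by positivity
    · exact hd1 ▸ by positivity
  have hJsum : ∑ s, ∑ w, J s w = 1 := by
    rw [Finset.sum_comm]
    simp only [hJd, D.sum_dist]
  have hJ1 : ∑ w, J 1 w = 1 - successProb (Real.sqrt θ) θ := by
    rw [Fin.sum_univ_two (f := fun s => ∑ w, J s w), hJ0] at hJsum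
    linarith
  have hH : ∑ w, D.dist w * Real.logb 2 (D.dist w) =
      -binEnt (Real.cos (Real.sqrt θ / 2) ^ 2) := by
    rw [Fin.sum_univ_two, hd0, hd1, Real.sin_sq, binEnt]
    ring
  set p := successProb (Real.sqrt θ) θ with hp
  set H := binEnt (Real.cos (Real.sqrt θ / 2) ^ 2) with hHdef
  have hrate : rateBound θ = 1 - p + H := rfl
  -- One δ is slack for the typical set, one for the number of failures; the other two absorb the
  -- rounding of k once 2δn ≥ 1.
  obtain ⟨δ, hδ, hδE⟩ : ∃ δ, 0 < δ ∧ 4 * δ = E - (1 - p + H) :=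
    ⟨(E - (1 - p + H)) / 4, by rw [hrate] at hE; linarith, by ring⟩
  obtain ⟨ρ₁, hρ₁, hρ₁', hT⟩ := exists_pow_bound_sum_prod (P := D.dist)
    (f := fun w => -Real.logb 2 (D.dist w) - (H + δ)) D.dist_nonneg D.sum_dist (by
      simp only [mul_sub, mul_neg, Finset.sum_sub_distrib, Finset.sum_neg_distrib, hH,
        ← Finset.sum_mul, D.sum_dist]
      linarith)
  obtain ⟨ρ₂, hρ₂, hρ₂', hS⟩ := exists_pow_bound_sum_prod (P := fun s => ∑ w, J s w)
    (f := fun s : Fin 2 => (if s = 1 then 1 else 0) - (1 - p + δ)) (fun s => (hJpos s).le) hJsum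
    (by
      simp only [mul_sub, Finset.sum_sub_distrib, ← Finset.sum_mul, hJsum, mul_ite, mul_one,
        mul_zero, Finset.sum_ite_eq', Finset.mem_univ, if_true, hJ1]
      linarith)
  -- The 1/2 in the maximum keeps ρ positive, so that its logarithm can be used.
  obtain ⟨ρ, hρ0, hρ1, hρ₁ρ, hρ₂ρ⟩ : ∃ ρ, 0 < ρ ∧ ρ < 1 ∧ ρ₁ ≤ ρ ∧ ρ₂ ≤ ρ :=
    ⟨max (max ρ₁ ρ₂) (1 / 2), by positivity, by simp [hρ₁', hρ₂']; norm_num, by simp, by simp⟩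
  obtain ⟨N, hN, hNlim⟩ := exists_threshold hρ0 hρ1 (⌈(2 * δ)⁻¹⌉₊ + 1)
  refine ⟨N, fun ε hε n hn => ?_, hNlim⟩
  obtain ⟨hn0, hnε⟩ := hN ε hε n hn
  have hnδ : 1 ≤ 2 * δ * n := by
    have : (2 * δ)⁻¹ ≤ n := (Nat.le_ceil _).trans (by exact_mod_cast (Nat.le_succ _).trans hn0)
    rwa [inv_le_iff_one_le_mul₀' (by positivity)] at this
  have hp1 : 0 < 1 - p := hJ1 ▸ hJpos 1
  -- The added 1 guarantees k > 0.
  let k : ℕ := ⌊n * (1 - p + δ)⌋₊ + 1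
  have hk : (k : ℝ) ≤ n * (1 - p + δ) + 1 := by
    simp only [k]
    push_cast
    have := Nat.floor_le (a := n * (1 - p + δ)) (by positivity)
    linarith
  let T := Finset.univ.filter fun w : Fin n → Fin 2 =>
    ¬ 0 ≤ ∑ i, (-Real.logb 2 (D.dist (w i)) - (H + δ))
  let S := Finset.univ.filter fun s : Fin n → Fin 2 =>
    ¬ 0 ≤ ∑ i, ((if s i = 1 then (1 : ℝ) else 0) - (1 - p + δ))
  have hTc : Tᶜ = Finset.univ.filter fun w : Fin n → Fin 2 =>
      0 ≤ ∑ i, (-Real.logb 2 (D.dist (w i)) - (H + δ)) := by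
    simp only [T, Finset.compl_filter, not_not]
  have hSc : Sᶜ = Finset.univ.filter fun s : Fin n → Fin 2 =>
      0 ≤ ∑ i, ((if s i = 1 then (1 : ℝ) else 0) - (1 - p + δ)) := by
    simp only [S, Finset.compl_filter, not_not]
  have hTcard : (T.card : ℝ) ≤ 2 ^ (n * (H + δ)) := card_typical_le hdpos D.sum_dist _
  have hScard : ∀ s ∈ S, (Finset.univ.filter fun i => s i = 1).card ≤ k := by
    intro s hs
    have h2 := not_le.1 (Finset.mem_filter.1 hs).2
    simp only [Finset.sum_sub_distrib, Finset.sum_boole, Finset.sum_const, Finset.card_univ,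
      Fintype.card_fin, nsmul_eq_mul] at h2
    exact (Nat.le_floor (by linarith)).trans (Nat.le_succ _)
  have hcard : T.card * 2 ^ k * B ^ n ≤ A ^ n := by
    have h2 : (2 : ℝ) ^ (n * E) = A ^ n / B ^ n := by
      rw [mul_comm, Real.rpow_mul (by norm_num), hEdef, Real.rpow_sub (by norm_num),
        Real.rpow_logb (by norm_num) (by norm_num) (by positivity),
        Real.rpow_logb (by norm_num) (by norm_num) (by positivity), Real.rpow_natCast, div_pow]
    have h3 : (T.card : ℝ) * 2 ^ k ≤ 2 ^ (n * E) := by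
      calc (T.card : ℝ) * 2 ^ k ≤ 2 ^ (n * (H + δ)) * 2 ^ (n * (1 - p + δ) + 1) := by
            rw [← Real.rpow_natCast 2 k]
            gcongr
            norm_num
        _ = 2 ^ (n * (H + δ) + (n * (1 - p + δ) + 1)) := by
            rw [← Real.rpow_add (by norm_num)]
        _ ≤ 2 ^ (n * E) := by
            refine Real.rpow_le_rpow_of_exponent_le (by norm_num) ?_
            linear_combination hnδ + n * hδE
    rw [h2, le_div_iff₀ (by positivity)] at h3
    exact_mod_cast h3
  obtain ⟨M, hM, hF⟩ := D.exists_isLOCC (by omega) (Nat.succ_pos _) (pow_pos hA n) (pow_pos hB n)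
    T S hScard hcard
  refine ⟨A ^ n, B ^ n, Nat.one_le_pow _ _ hA, Nat.one_le_pow _ _ hB, ⟨M, hM, le_trans ?_ hF⟩, ?_⟩
  · have h2 := one_sub_le_sum_sq_sum_prod hJ hJpos hJsum S T
    simp only [hamp]
    refine le_trans ?_ h2
    simp only [hJd]
    rw [hTc, hSc]
    have h3 := (hT n).trans (pow_le_pow_left₀ hρ₁ hρ₁ρ n)
    have h4 := (hS n).trans (pow_le_pow_left₀ hρ₂ hρ₂ρ n)
    linarith
  · push_cast
    rw [Real.logb_pow, Real.logb_pow, hEdef]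
    ring

/-- Positive rationals are dense, so logarithms of rationals lie between `rateBound θ` and any
larger z. -/
theorem entanglementCost_gate_le {θ : ℝ} (h0 : 0 < θ) (h1 : θ ≤ Real.pi / 2) :
    entanglementCost 4 (gate θ) ≤ ((rateBound θ : ℝ) : EReal) := by
  refine EReal.le_of_forall_lt_iff_le.1 fun z hz => ?_
  have hz' : rateBound θ < z := by exact_mod_cast hz
  obtain ⟨q, hq1, hq2⟩ := exists_rat_btwn
    (Real.rpow_lt_rpow_of_exponent_lt (by norm_num : (1 : ℝ) < 2) hz')
  have hq0 : (0 : ℝ) < q := (Real.rpow_pos_of_pos (by norm_num) _).trans hq1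
  have hq0' : 0 < q := by exact_mod_cast hq0
  have hnum : 0 < q.num.toNat := by
    have := Rat.num_pos.2 hq0'
    omega
  have hqe : (q : ℝ) = (q.num.toNat : ℝ) / (q.den : ℝ) := by
    have h2 : ((q.num.toNat : ℤ) : ℝ) = (q.num : ℝ) := by
      rw [Int.toNat_of_nonneg (Rat.num_pos.2 hq0').le]
    rw [← Int.cast_natCast q.num.toNat, h2]
    exact Rat.cast_def q
  have hE : Real.logb 2 q = Real.logb 2 q.num.toNat - Real.logb 2 q.den := by
    rw [hqe, Real.logb_div (by positivity) (by have := q.den_pos; positivity)]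
  have h3 : rateBound θ < Real.logb 2 q := by
    rwa [Real.lt_logb_iff_rpow_lt (by norm_num) hq0]
  have h4 : Real.logb 2 q ≤ z := by
    rw [Real.logb_le_iff_le_rpow (by norm_num) hq0]
    exact hq2.le
  have h5 := achievable_of_rateBound_lt h0 h1 hnum q.den_pos (hE ▸ h3)
  rw [← hE] at h5
  have h6 : entanglementCost 4 (gate θ) ≤ ((Real.logb 2 q : ℝ) : EReal) := sInf_le ⟨_, h5, rfl⟩
  exact h6.trans (EReal.coe_le_coe_iff.2 h4)

/-- At error 1/2 the fidelity bound gives K/L ≥ 1/2, that is nE ≥ -1 for all large n, which fails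
eventually when E < 0. -/
theorem Achievable.nonneg {θ E : ℝ} {r : ℕ} (h : Achievable (gate θ) r E) : 0 ≤ E := by
  obtain ⟨N, hN, -⟩ := h
  by_contra! hE
  obtain ⟨m, hm⟩ := exists_nat_gt (-1 / E)
  obtain ⟨K, L, hK, hL, ⟨M, hM, hF⟩, hcost⟩ := hN (1 / 2) (by norm_num) (max (N (1 / 2)) m)
    (le_max_left _ _)
  set n := max (N (1 / 2)) m
  have hn : (m : ℝ) ≤ n := by exact_mod_cast le_max_right _ _
  have h1 : (1 / 2 : ℝ) ≤ K / L := by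
    have := fidelity_le_of_isLOCC (θ := θ) hK hM
    linarith
  have hK0 : (0 : ℝ) < K := by exact_mod_cast hK
  have hL0 : (0 : ℝ) < L := by exact_mod_cast hL
  have h2 : -1 ≤ n * E := by
    rw [← hcost, ← Real.logb_div hK0.ne' hL0.ne',
      Real.le_logb_iff_rpow_le (by norm_num) (by positivity), Real.rpow_neg_one]
    linarith
  have h3 : n * E < -1 := by
    rw [div_lt_iff_of_neg hE] at hm
    nlinarith
  linarith

theorem entanglementCost_gate_nonneg (r : ℕ) (θ : ℝ) : 0 ≤ entanglementCost r (gate θ) := by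
  refine le_sInf ?_
  rintro _ ⟨E, hE, rfl⟩
  exact EReal.coe_nonneg.2 (Achievable.nonneg hE)

end RoundTradeoff

theorem mainTheorem2 :
    (∀ θ : ℝ, 0 < θ → θ ≤ Real.pi / 2 →
      RoundTradeoff.entanglementCost 4 (RoundTradeoff.gate θ) ≤
        ((RoundTradeoff.rateBound θ : ℝ) : EReal)) ∧
    Tendsto RoundTradeoff.rateBound (𝓝[>] 0) (𝓝 0) ∧
    (∃ θmax : ℝ, 0 < θmax ∧ θmax ≤ Real.pi / 2 ∧ ∀ θ : ℝ, 0 < θ → θ ≤ θmax →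
      RoundTradeoff.entanglementCost 4 (RoundTradeoff.gate θ) < 1) ∧
    Tendsto (fun θ : ℝ => RoundTradeoff.entanglementCost 4 (RoundTradeoff.gate θ))
      (𝓝[>] 0) (𝓝 (0 : EReal)) := by
  have hle : ∀ θ : ℝ, 0 < θ → θ ≤ Real.pi / 2 →
      RoundTradeoff.entanglementCost 4 (RoundTradeoff.gate θ) ≤
        ((RoundTradeoff.rateBound θ : ℝ) : EReal) :=
    fun θ => RoundTradeoff.entanglementCost_gate_le
  have hpi : 0 < Real.pi / 2 := by positivity
  refine ⟨hle, RoundTradeoff.tendsto_rateBound, ?_, ?_⟩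
  · obtain ⟨t, ht, hlt⟩ := mem_nhdsGT_iff_exists_Ioc_subset.1
      (RoundTradeoff.tendsto_rateBound.eventually (eventually_lt_nhds zero_lt_one))
    refine ⟨min t (Real.pi / 2), lt_min ht hpi, min_le_right _ _, fun θ h0 hθ => ?_⟩
    refine (hle θ h0 (hθ.trans (min_le_right _ _))).trans_lt ?_
    exact_mod_cast hlt ⟨h0, hθ.trans (min_le_left _ _)⟩
  · have hlim : Tendsto (fun θ => ((RoundTradeoff.rateBound θ : ℝ) : EReal)) (𝓝[>] 0)
        (𝓝 ((0 : ℝ) : EReal)) := EReal.tendsto_coe.2 RoundTradeoff.tendsto_rateBound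
    refine tendsto_of_tendsto_of_tendsto_of_le_of_le' tendsto_const_nhds hlim
      (Eventually.of_forall fun θ => RoundTradeoff.entanglementCost_gate_nonneg 4 θ) ?_
    filter_upwards [Ioc_mem_nhdsGT hpi] with θ hθ
    exact hle θ hθ.1 hθ.2
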